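/- **Theorem 2.4.** Let $(R,\mathfrak m)$ be a commutative Noetherian local ring, $\mathfrak a$ an ideal of $R$ and $M$ a finitely generated $R$-module. For each integer $i\ge 0$ let $$\mathfrak F^i_{\mathfrak a}(M):=\varprojlim_n H^i_{\mathfrak m}(M/\mathfrak a^nM)$$ be the $i$-th formal local cohomology module of $M$ with respect to $\mathfrak a$, where $H^i_{\mathfrak m}$ denotes local cohomology with support in $\mathfrak m$. For an $R$-module $X$ let $\operatorname{Coass}_R(X)$ be the set of prime ideals $\mathfrak p$ of $R$ such that $\mathfrak p=\operatorname{Ann}_R(Y)$ for some Artinian quotient $Y$ of $X$, and let $V(\mathfrak a)$ be the set of prime ideals of $R$ containing $\mathfrak a$. Let $t\ge 0$ be an integer such that the $R$-module $\mathfrak F^i_{\mathfrak a}(M)$ is Artinian for all $i>t$. Then the $R$-module $\mathfrak F^t_{\mathfrak a}(M)/\mathfrak a\,\mathfrak F^t_{\mathfrak a}(M)$ is Artinian, and the set $\operatorname{Coass}_R(\mathfrak F^t_{\mathfrak a}(M))\cap V(\mathfrak a)$ is finite. -/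

import Mathlib

open CategoryTheory

universe u

noncomputable section

/-- The inverse system `⋯ ⟶ M/𝔞ⁿ⁺¹M ⟶ M/𝔞ⁿM ⟶ ⋯ ⟶ M/𝔞⁰M` of `R`-modules, whose transition maps
are the natural projections. -/
def adicQuotientSystem {R : Type u} [CommRing R] (𝔞 : Ideal R)
    (M : Type u) [AddCommGroup M] [Module R M] : ℕᵒᵖ ⥤ ModuleCat.{u} R where
  obj n := ModuleCat.of R (M ⧸ (𝔞 ^ n.unop • ⊤ : Submodule R M))
  map f := ModuleCat.ofHom (Submodule.factor
    (Submodule.smul_mono_left (Ideal.pow_le_pow_right f.unop.le)))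
  map_id n := by
    ext x
    simp
  map_comp f g := by
    ext x
    simp

/-- The `i`-th formal local cohomology module `𝔉ⁱ_𝔞(M) = lim_n Hⁱ_𝔪(M/𝔞ⁿM)` of a module `M` over a
local ring `(R, 𝔪)` with respect to the ideal `𝔞`. -/
def formalLocalCohomology {R : Type u} [CommRing R] [IsLocalRing R] (𝔞 : Ideal R) (i : ℕ)
    (M : Type u) [AddCommGroup M] [Module R M] : ModuleCat.{u} R :=
  Limits.limit (adicQuotientSystem 𝔞 M ⋙ localCohomology (IsLocalRing.maximalIdeal R) i)

/-- The set of coassociated primes of `X`: the prime ideals of the form `Ann_R Y`, where `Y` is an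
Artinian quotient of `X`. -/
def coassociatedPrimes (R : Type*) [CommRing R] (X : Type*) [AddCommGroup X] [Module R X] :
    Set (PrimeSpectrum R) :=
  {𝔭 | ∃ N : Submodule R X, IsArtinian R (X ⧸ N) ∧ 𝔭.asIdeal = Module.annihilator R (X ⧸ N)}

end

/-! Write `F^i(M)` for formal local cohomology. The first claim is proved by Noetherian induction
over the quotients of `M` (`isArtinian_formalHomology_quotient`). A map `f : N → M` with cokernel
`Q` gives short exact sequences `0 → N/f⁻¹(𝔞ⁿM) → M/𝔞ⁿM → Q/𝔞ⁿQ → 0`. Local cohomology of finite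
modules at the maximal ideal is Artinian (`isArtinian_localHomology`), and sequential limits are
exact on such systems (`limMap_exact`), so a long exact sequence survives in the limit.

If some `q ≠ 0` is killed by `𝔞`, take `N = Rq`. By Artin–Rees the left system is eventually
constant, so its limits are Artinian. Otherwise `𝔞` contains an `M`-regular `x`; take `f` to be
multiplication by `x`. By Artin–Rees the left filtration is cofinal with the `𝔞`-adic one, so in
degree `t` the left limit maps into `x F^t(M) ⊆ 𝔞 F^t(M)`. In both cases `F^i(Q)` is Artinian for `i
> t`, induction applies to `Q`, and `isArtinian_quotient_smul_top_of_exact` carries the conclusion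
back to `M`.

For the second claim, a coassociated prime containing `𝔞` is the annihilator of a quotient of the
Artinian module `F^t/𝔞F^t`. An Artinian module has only finitely many such primes, by decomposition
into sum-irreducible submodules (`finite_setOf_eq_colon`). -/

open Limits Opposite

/-! ### A functorial cochain complex for local cohomology. -/

noncomputable section

namespace localCohomology

variable {R : Type u} [CommRing R]

/-- Exactness lets homology and short exact sequences pass through `colim`. The shape `ℕᵒᵖᵒᵖ` is the
one over which `localCohomology` takes its colimit. -/
instance hasExactColimitsOfShape_nat : HasExactColimitsOfShape ℕᵒᵖᵒᵖ (ModuleCat.{u} R) :=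
  have : AB5OfSize.{0, 0} (ModuleCat.{u} R) := AB5OfSize_of_univLE.{0, 0, u, u} _
  inferInstance

instance colim_linear : (colim : (ℕᵒᵖᵒᵖ ⥤ ModuleCat.{u} R) ⥤ ModuleCat.{u} R).Linear R where
  map_smul f r := by
    apply colimit.hom_ext
    intro j
    simp

instance colim_preservesHomology :
    (colim : (ℕᵒᵖᵒᵖ ⥤ ModuleCat.{u} R) ⥤ ModuleCat.{u} R).PreservesHomology :=
  inferInstance

variable (J : Ideal R)

/-- A projective resolution of `R ⧸ J ^ k`. -/
def powerResolution (k : ℕ) : ProjectiveResolution (ModuleCat.of R (R ⧸ J ^ k)) :=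
  projectiveResolution _

/-- The inverse system of the resolutions of the modules `R ⧸ J ^ k`. -/
def resolutionTower : ℕᵒᵖ ⥤ ChainComplex (ModuleCat.{u} R) ℕ :=
  Functor.ofOpSequence (X := fun k => (powerResolution J k).complex) fun k =>
    ProjectiveResolution.lift ((ringModIdeals (idealPowersDiagram J)).map (homOfLE k.le_succ).op)
      (powerResolution J (k + 1)) (powerResolution J k)

/-- The augmentation of `resolutionTower`. -/
def resolutionTowerπ : resolutionTower J ⟶
    ringModIdeals (idealPowersDiagram J) ⋙ ChainComplex.single₀ (ModuleCat.{u} R) :=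
  NatTrans.ofOpSequence (fun k => (powerResolution J k).π) fun k => by
    simp only [resolutionTower, Functor.ofOpSequence_map_homOfLE_succ]
    exact ProjectiveResolution.lift_commutes _ _ _

/-- The cochain complex of direct systems `k ↦ Hom(P^k, N)`, where `P^k` is the resolution of
`R ⧸ J ^ k`. -/
def homSystem : ModuleCat.{u} R ⥤ CochainComplex (ℕᵒᵖᵒᵖ ⥤ ModuleCat.{u} R) ℕ where
  obj N :=
    { X := fun i => (resolutionTower J ⋙ HomologicalComplex.eval _ _ i).op ⋙
        (linearYoneda R (ModuleCat.{u} R)).obj N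
      d := fun i j => Functor.whiskerRight (NatTrans.op (Functor.whiskerLeft (resolutionTower J)
        (HomologicalComplex.dNatTrans _ _ j i))) _
      shape := fun i j hij => by
        ext k x
        have h := ((resolutionTower J).obj k.unop).shape j i hij
        have aux : ∀ y : ((resolutionTower J).obj k.unop).X i ⟶ N,
            ((resolutionTower J).obj k.unop).d j i ≫ y = 0 := fun y => by rw [h, zero_comp]
        exact aux x
      d_comp_d' := fun i j l _ _ => by
        ext k x
        have h := ((resolutionTower J).obj k.unop).d_comp_d l j i
        have aux : ∀ y : ((resolutionTower J).obj k.unop).X i ⟶ N,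
            ((resolutionTower J).obj k.unop).d l j ≫ ((resolutionTower J).obj k.unop).d j i ≫ y
              = 0 := fun y => by rw [reassoc_of% h, zero_comp]
        exact aux x }
  map f :=
    { f := fun i => Functor.whiskerLeft _ ((linearYoneda R (ModuleCat.{u} R)).map f)
      comm' := fun i j _ => by
        ext k : 2
        dsimp
        exact (((linearYoneda R (ModuleCat.{u} R)).map f).naturality _).symm }
  map_id N := by
    ext i : 1
    dsimp
    rw [CategoryTheory.Functor.map_id, Functor.whiskerLeft_id']
  map_comp f g := by
    ext i : 1
    dsimp
    rw [Functor.map_comp, Functor.whiskerLeft_comp]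

/-- The complex `colim_k Hom(P^k, N)`, where `P^k` is the resolution of `R ⧸ J ^ k`. -/
def localComplex : ModuleCat.{u} R ⥤ CochainComplex (ModuleCat.{u} R) ℕ :=
  homSystem J ⋙ colim.mapHomologicalComplex _

/-- The cohomology of `localComplex`. -/
def localHomology (i : ℕ) : ModuleCat.{u} R ⥤ ModuleCat.{u} R :=
  localComplex J ⋙ HomologicalComplex.homologyFunctor _ _ i

end localCohomology
end

/-! ### Comparison with the colimit of Ext modules. -/

noncomputable section

namespace HomologicalComplex

variable {ι V : Type*} [Category* V] [Abelian V] {c : ComplexShape ι}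

lemma homologyUnop_hom_naturality {K L : HomologicalComplex Vᵒᵖ c} (ψ : K ⟶ L) (i : ι) :
    (L.homologyUnop i).hom ≫ (homologyMap ψ i).unop =
      homologyMap ((unopFunctor V c).map ψ.op) i ≫ (K.homologyUnop i).hom :=
  Quiver.Hom.op_inj
    (homologyOp_hom_naturality ((unopFunctor V c).map ψ.op) i).symm.symm

end HomologicalComplex

namespace localCohomology

variable {R : Type u} [CommRing R]

/-- Stated for abstract objects so that the Ext squares below match it up to definitional unfolding,
without rewriting. -/
lemma comp_inv_naturality {C : Type*} [Category* C] {X Y X' Y' X'' Y'' : C} {a : X ⟶ Y}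
    {q : X ⟶ X'} {p : Y ⟶ Y'} {m : X' ⟶ Y'} {e : X'' ≅ X'} {e' : Y'' ≅ Y'} {h : X'' ⟶ Y''}
    (h₁ : a ≫ p = q ≫ m) (h₂ : e.hom ≫ m = h ≫ e'.hom) :
    a ≫ p ≫ e'.inv = (q ≫ e.inv) ≫ h := by
  have h₃ : m ≫ e'.inv = e.inv ≫ h := by
    rw [Iso.comp_inv_eq, Category.assoc, ← h₂, Iso.inv_hom_id_assoc]
  rw [reassoc_of% h₁, Category.assoc, h₃]

lemma inv_comp_inv_naturality {C : Type*} [Category* C] {X Y X' Y' X'' Y'' : C} {a : X ⟶ Y}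
    {p : X' ≅ X} {q : Y' ≅ Y} {b : X' ⟶ Y'} {e : X'' ≅ X'} {e' : Y'' ≅ Y'} {c : X'' ⟶ Y''}
    (h₁ : a = p.inv ≫ b ≫ q.hom) (h₂ : c ≫ e'.hom = e.hom ≫ b) :
    a ≫ q.inv ≫ e'.inv = (p.inv ≫ e.inv) ≫ c := by
  have h₃ : b ≫ e'.inv = e.inv ≫ c := by
    rw [Iso.comp_inv_eq, Category.assoc, h₂, Iso.inv_hom_id_assoc]
  rw [h₁, Category.assoc, Category.assoc, Iso.hom_inv_id_assoc, Category.assoc, h₃]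

/-- Functoriality of `ChainComplex.linearYonedaObj` in the complex. -/
def linearYonedaMapLeft {C D : ChainComplex (ModuleCat.{u} R) ℕ} (φ : C ⟶ D) (N : ModuleCat.{u} R) :
    D.linearYonedaObj R N ⟶ C.linearYonedaObj R N :=
  (HomologicalComplex.unopFunctor _ _).map
    ((((linearYoneda R (ModuleCat.{u} R)).obj N).rightOp.mapHomologicalComplex _).map φ).op

/-- Functoriality of `ChainComplex.linearYonedaObj` in the module. -/
def linearYonedaMapRight (C : ChainComplex (ModuleCat.{u} R) ℕ) {N N' : ModuleCat.{u} R}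
    (f : N ⟶ N') :
    C.linearYonedaObj R N ⟶ C.linearYonedaObj R N' :=
  (HomologicalComplex.unopFunctor _ _).map
    ((NatTrans.mapHomologicalComplex (NatTrans.rightOp ((linearYoneda R (ModuleCat.{u} R)).map f))
      (ComplexShape.down ℕ)).app C).op

/-- `isoExt` is built from the left derived functor of the opposite of `Hom(-, N)` followed by
`homologyUnop`; the squares of these two are pasted. -/
lemma isoExt_hom_naturality_left {X Y : ModuleCat.{u} R} (f : X ⟶ Y) (P : ProjectiveResolution X)
    (Q : ProjectiveResolution Y) (φ : P.complex ⟶ Q.complex)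
    (comm : φ.f 0 ≫ Q.π.f 0 = P.π.f 0 ≫ f) (N : ModuleCat.{u} R) (n : ℕ) :
    ((Ext R (ModuleCat.{u} R) n).map f.op).app N ≫ (P.isoExt n N).hom =
      (Q.isoExt n N).hom ≫ HomologicalComplex.homologyMap (linearYonedaMapLeft φ N) n := by
  have h1 := P.isoLeftDerivedObj_inv_naturality f Q φ comm
    ((linearYoneda R (ModuleCat.{u} R)).obj N).rightOp n
  have h2 := HomologicalComplex.homologyUnop_hom_naturality
    ((((linearYoneda R (ModuleCat.{u} R)).obj N).rightOp.mapHomologicalComplex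
      (ComplexShape.down ℕ)).map φ) n
  exact comp_inv_naturality (congrArg Quiver.Hom.unop h1) h2

lemma isoExt_hom_naturality_right {X : ModuleCat.{u} R} (P : ProjectiveResolution X)
    {N N' : ModuleCat.{u} R} (f : N ⟶ N') (n : ℕ) :
    ((Ext R (ModuleCat.{u} R) n).obj (op X)).map f ≫ (P.isoExt n N').hom =
      (P.isoExt n N).hom ≫
        HomologicalComplex.homologyMap (linearYonedaMapRight P.complex f) n := by
  have h1 := P.leftDerived_app_eq (NatTrans.rightOp ((linearYoneda R (ModuleCat.{u} R)).map f)) n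
  have h1' := (Iso.inv_comp_eq _).2 h1
  have h2 := HomologicalComplex.homologyUnop_hom_naturality
    ((NatTrans.mapHomologicalComplex (NatTrans.rightOp ((linearYoneda R (ModuleCat.{u} R)).map f))
      (ComplexShape.down ℕ)).app P.complex) n
  exact comp_inv_naturality (congrArg Quiver.Hom.unop h1') h2

variable (J : Ideal R)

/-- The cohomology of `homSystem` is the direct system of the modules `Ext(R ⧸ J ^ k, N)`. -/
def homSystemHomologyObjIso (i : ℕ) (N : ModuleCat.{u} R) (k : ℕᵒᵖᵒᵖ) :
    (((homSystem J).obj N).homology i).obj k ≅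
      ((Ext R (ModuleCat.{u} R) i).obj (op (ModuleCat.of R (R ⧸ J ^ k.unop.unop)))).obj N :=
  ((((homSystem J).obj N).sc i).mapHomologyIso ((evaluation _ _).obj k)).symm ≪≫
    ((powerResolution J k.unop.unop).isoExt i N).symm

lemma resolutionTower_comm {k l : ℕᵒᵖ} (f : k ⟶ l) :
    ((resolutionTower J).map f).f 0 ≫ (powerResolution J l.unop).π.f 0 =
      (powerResolution J k.unop).π.f 0 ≫ (ringModIdeals (idealPowersDiagram J)).map f :=
  HomologicalComplex.congr_hom ((resolutionTowerπ J).naturality f) 0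

/-- `homSystemHomologyObjIso` as an isomorphism of direct systems. -/
def homSystemHomologyIso (i : ℕ) (N : ModuleCat.{u} R) :
    ((homSystem J).obj N).homology i ≅
      (diagram (idealPowersDiagram J) i).flip.obj N :=
  NatIso.ofComponents (homSystemHomologyObjIso J i N) fun {k l} f => by
    have h1 := isoExt_hom_naturality_left _ (powerResolution J l.unop.unop)
      (powerResolution J k.unop.unop) _ (resolutionTower_comm J f.unop) N i
    have h2 := NatTrans.app_homology ((evaluation _ (ModuleCat.{u} R)).map f)
      (((homSystem J).obj N).sc i)
    exact inv_comp_inv_naturality h2 h1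

/-- `homSystemHomologyIso` as an isomorphism of functors. -/
def homSystemHomologyNatIso (i : ℕ) :
    homSystem J ⋙ HomologicalComplex.homologyFunctor _ _ i ≅
      (diagram (idealPowersDiagram J) i).flip :=
  NatIso.ofComponents (homSystemHomologyIso J i) fun {N N'} f => by
    ext k : 2
    have h1 := isoExt_hom_naturality_right (powerResolution J k.unop.unop) f i
    have h2 := ShortComplex.mapHomologyIso_hom_naturality
      ((HomologicalComplex.shortComplexFunctor _ _ i).map ((homSystem J).map f))
      ((evaluation _ (ModuleCat.{u} R)).obj k)
    exact inv_comp_inv_naturality ((Iso.eq_inv_comp _).2 h2.symm) h1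

/-- Local cohomology is computed by `localComplex`. -/
def isoLocalHomology (i : ℕ) : localCohomology J i ≅ localHomology J i :=
  colimitIsoFlipCompColim _ ≪≫
    Functor.isoWhiskerRight (homSystemHomologyNatIso J i).symm colim ≪≫
    NatIso.ofComponents (fun N => ((((homSystem J).obj N).sc i).mapHomologyIso colim).symm)
      fun f => by
        have h := ShortComplex.mapHomologyIso_hom_naturality
          ((HomologicalComplex.shortComplexFunctor _ _ i).map ((homSystem J).map f))
          (colim : (ℕᵒᵖᵒᵖ ⥤ ModuleCat.{u} R) ⥤ ModuleCat.{u} R)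
        exact (Iso.eq_inv_comp _).2 ((Category.assoc _ _ _).symm.trans
          ((Iso.comp_inv_eq _).2 h.symm))

end localCohomology
end

/-! ### Long exact sequence and vanishing on injectives. -/

noncomputable section

namespace localCohomology

variable {R : Type u} [CommRing R]

lemma exact_of_evaluation {K : Type*} [Category* K] (S : ShortComplex (K ⥤ ModuleCat.{u} R))
    (h : ∀ k, (S.map ((evaluation _ _).obj k)).Exact) : S.Exact := by
  rw [ShortComplex.exact_iff_isZero_homology]
  refine Functor.isZero _ fun k => ?_
  exact IsZero.of_iso ((ShortComplex.exact_iff_isZero_homology _).1 (h k))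
    (S.mapHomologyIso ((evaluation _ _).obj k)).symm

lemma shortExact_of_evaluation {K : Type*} [Category* K] (S : ShortComplex (K ⥤ ModuleCat.{u} R))
    (h : ∀ k, (S.map ((evaluation _ _).obj k)).ShortExact) : S.ShortExact where
  exact := exact_of_evaluation S fun k => (h k).exact
  mono_f := have (k : K) : Mono (S.f.app k) := (h k).mono_f
    NatTrans.mono_of_mono_app _
  epi_g := have (k : K) : Epi (S.g.app k) := (h k).epi_g
    NatTrans.epi_of_epi_app _

variable (J : Ideal R)

instance homSystem_linear : (homSystem J).Linear R where
  map_smul {X Y} f r := by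
    ext i k x
    have aux : ∀ y : ((resolutionTower J).obj k.unop).X i ⟶ X, y ≫ (r • f) = r • (y ≫ f) :=
      fun y => Linear.comp_smul ..
    exact aux x

instance homSystem_additive : (homSystem J).Additive where
  map_add {X Y} f g := by
    ext i k x
    have aux : ∀ y : ((resolutionTower J).obj k.unop).X i ⟶ X, y ≫ (f + g) = y ≫ f + y ≫ g :=
      fun y => Preadditive.comp_add ..
    exact aux x

instance localComplex_additive : (localComplex J).Additive :=
  inferInstanceAs (homSystem J ⋙ colim.mapHomologicalComplex _).Additive

instance localComplex_linear : (localComplex J).Linear R :=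
  inferInstanceAs ((homSystem J ⋙ colim.mapHomologicalComplex _).Linear R)

lemma localHomology_map_smul {N N' : ModuleCat.{u} R} (f : N ⟶ N') (r : R) (i : ℕ) :
    (localHomology J i).map (r • f) = r • (localHomology J i).map f := by
  change HomologicalComplex.homologyMap ((localComplex J).map (r • f)) i = _
  rw [Functor.map_smul]
  exact ShortComplex.homologyMap_smul
    ((HomologicalComplex.shortComplexFunctor _ _ i).map ((localComplex J).map f)) r

instance powerResolution_projective (k i : ℕ) :
    Projective ((powerResolution J k).complex.X i) :=
  (powerResolution J k).projective i

/-- The terms of the resolutions are projective, so `Hom` out of them is exact, and `colim` is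
exact. -/
lemma localComplex_shortExact {S : ShortComplex (ModuleCat.{u} R)} (hS : S.ShortExact) :
    (S.map (localComplex J)).ShortExact := by
  refine HomologicalComplex.shortExact_of_degreewise_shortExact _ fun i => ?_
  have h : (S.map (homSystem J ⋙ HomologicalComplex.eval _ _ i)).ShortExact := by
    refine shortExact_of_evaluation _ fun k => ?_
    have := hS.mono_f
    have := hS.epi_g
    refine ModuleCat.shortComplex_shortExact _ ?_ ?_ ?_
    · intro y
      have aux : ∀ z : (powerResolution J k.unop.unop).complex.X i ⟶ S.X₂,
          z ≫ S.g = 0 ↔ z ∈ Set.range (fun w : _ ⟶ S.X₁ => w ≫ S.f) := by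
        intro z
        refine ⟨fun hz => ⟨hS.exact.lift z hz, hS.exact.lift_f z hz⟩, ?_⟩
        rintro ⟨w, rfl⟩
        simp
      exact aux y
    · have aux : Function.Injective
          (fun w : (powerResolution J k.unop.unop).complex.X i ⟶ S.X₁ => w ≫ S.f) :=
        fun w w' hw => (cancel_mono S.f).1 hw
      exact aux
    · have aux : Function.Surjective
          (fun w : (powerResolution J k.unop.unop).complex.X i ⟶ S.X₂ => w ≫ S.g) :=
        fun w => ⟨Projective.factorThru w S.g, Projective.factorThru_comp w S.g⟩
      exact aux
  exact h.map_of_exact colim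

variable {J}

/-- The connecting homomorphism of the long exact sequence of local cohomology. -/
def localδ {S : ShortComplex (ModuleCat.{u} R)} (hS : S.ShortExact) (i : ℕ) :
    (localHomology J i).obj S.X₃ ⟶ (localHomology J (i + 1)).obj S.X₁ :=
  (localComplex_shortExact J hS).δ i (i + 1) rfl

lemma localδ_naturality {S T : ShortComplex (ModuleCat.{u} R)} (hS : S.ShortExact)
    (hT : T.ShortExact) (φ : S ⟶ T) (i : ℕ) :
    localδ (J := J) hS i ≫ (localHomology J (i + 1)).map φ.τ₁ =
      (localHomology J i).map φ.τ₃ ≫ localδ hT i :=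
  HomologicalComplex.HomologySequence.δ_naturality
    ((localComplex J).mapShortComplex.map φ) (localComplex_shortExact J hS)
    (localComplex_shortExact J hT) i (i + 1) rfl

lemma localHomology_exact₂ {S : ShortComplex (ModuleCat.{u} R)} (hS : S.ShortExact) (i : ℕ) :
    Function.Exact ((localHomology J i).map S.f) ((localHomology J i).map S.g) :=
  (ShortComplex.ShortExact.moduleCat_exact_iff_function_exact _).1
    ((localComplex_shortExact J hS).homology_exact₂ i)

lemma localHomology_exact₃ {S : ShortComplex (ModuleCat.{u} R)} (hS : S.ShortExact) (i : ℕ) :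
    Function.Exact ((localHomology J i).map S.g) (localδ (J := J) hS i) :=
  (ShortComplex.ShortExact.moduleCat_exact_iff_function_exact _).1
    ((localComplex_shortExact J hS).homology_exact₃ i (i + 1) rfl)

lemma localHomology_exact₁ {S : ShortComplex (ModuleCat.{u} R)} (hS : S.ShortExact) (i : ℕ) :
    Function.Exact (localδ (J := J) hS i) ((localHomology J (i + 1)).map S.f) :=
  (ShortComplex.ShortExact.moduleCat_exact_iff_function_exact _).1
    ((localComplex_shortExact J hS).homology_exact₁ i (i + 1) rfl)

variable (J)

/-- `Hom(-, E)` keeps the resolutions exact in positive degrees, and `colim` preserves this. -/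
lemma localHomology_subsingleton_of_injective (E : ModuleCat.{u} R) [Injective E] (i : ℕ) :
    Subsingleton ((localHomology J (i + 1)).obj E) := by
  have h : (((homSystem J).obj E).sc' i (i + 1) (i + 2)).Exact := by
    refine exact_of_evaluation _ fun k => ?_
    refine (ShortComplex.moduleCat_exact_iff _).2 ?_
    have hP : ((powerResolution J k.unop.unop).complex.sc' (i + 2) (i + 1) i).Exact := by
      have := (powerResolution J k.unop.unop).exact_succ i
      exact this
    have aux : ∀ z : (powerResolution J k.unop.unop).complex.X (i + 1) ⟶ E,
        (powerResolution J k.unop.unop).complex.d (i + 2) (i + 1) ≫ z = 0 →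
        ∃ w, (powerResolution J k.unop.unop).complex.d (i + 1) i ≫ w = z :=
      fun z hz => ⟨hP.descToInjective z hz, hP.comp_descToInjective z hz⟩
    exact aux
  have h' : (((localComplex J).obj E).sc' i (i + 1) (i + 2)).Exact := h.map colim
  have h'' : ((localComplex J).obj E).ExactAt (i + 1) := by
    rw [HomologicalComplex.exactAt_iff' _ i (i + 1) (i + 2) (by simp) (by simp)]
    exact h'
  exact ModuleCat.subsingleton_of_isZero ((HomologicalComplex.exactAt_iff_isZero_homology _ _).1 h'')

end localCohomology
end

/-! ### Degree zero: classes as maps out of `R ⧸ J ^ k`. -/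

noncomputable section

namespace CochainComplex

variable {R : Type u} [CommRing R] (K L : CochainComplex (ModuleCat.{u} R) ℕ)

/-- The inclusion of `H⁰` into the degree zero part of a cochain complex. -/
def homologyZeroι : K.homology 0 ⟶ K.X 0 :=
  K.isoHomologyπ₀.inv ≫ K.iCycles 0

lemma homologyZeroι_injective : Function.Injective (homologyZeroι K) := by
  have : Mono (homologyZeroι K) := mono_comp _ _
  exact (ModuleCat.mono_iff_injective _).1 this

variable {K L} in
lemma homologyZeroι_naturality (φ : K ⟶ L) :
    HomologicalComplex.homologyMap φ 0 ≫ homologyZeroι L = homologyZeroι K ≫ φ.f 0 := by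
  simp [homologyZeroι]

lemma d_homologyZeroι (a : K.homology 0) : K.d 0 1 (homologyZeroι K a) = 0 := by
  have : homologyZeroι K ≫ K.d 0 1 = 0 := by simp [homologyZeroι]
  exact congrArg (fun f => f.hom a) this

lemma exists_homologyZeroι_eq (z : K.X 0) (hz : K.d 0 1 z = 0) :
    ∃ a, homologyZeroι K a = z := by
  let f : ModuleCat.of R R ⟶ K.X 0 := ModuleCat.ofHom (LinearMap.toSpanSingleton R _ z)
  have hf : f ≫ K.d 0 1 = 0 := by
    ext
    simpa [f] using hz
  refine ⟨(K.liftCycles f 1 (by simp) hf ≫ K.isoHomologyπ₀.hom) 1, ?_⟩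
  have : (K.liftCycles f 1 (by simp) hf ≫ K.isoHomologyπ₀.hom) ≫ homologyZeroι K = f := by
    simp [homologyZeroι]
  refine (congrArg (fun g => g.hom 1) this).trans ?_
  simp [f]

end CochainComplex

namespace localCohomology

variable {R : Type u} [CommRing R] (J : Ideal R)

/-- The inclusion of `H⁰` into the degree zero part of `localComplex`. -/
def localHomologyZeroι (N : ModuleCat.{u} R) :
    (localHomology J 0).obj N →ₗ[R] ((localComplex J).obj N).X 0 :=
  (CochainComplex.homologyZeroι ((localComplex J).obj N)).hom

lemma localHomologyZeroι_injective (N : ModuleCat.{u} R) :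
    Function.Injective (localHomologyZeroι J N) :=
  CochainComplex.homologyZeroι_injective _

lemma localHomologyZeroι_naturality {N N' : ModuleCat.{u} R} (f : N ⟶ N')
    (a : (localHomology J 0).obj N) :
    localHomologyZeroι J N' ((localHomology J 0).map f a) =
      ((localComplex J).map f).f 0 (localHomologyZeroι J N a) :=
  congrArg (fun g => g.hom a) (CochainComplex.homologyZeroι_naturality ((localComplex J).map f))

/-- The degree zero cochain of `localComplex` defined by a linear map `R ⧸ J ^ k → N`. -/
def homClass (N : ModuleCat.{u} R) (k : ℕᵒᵖᵒᵖ) :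
    (ModuleCat.of R (R ⧸ J ^ k.unop.unop) ⟶ N) →ₗ[R] ((localComplex J).obj N).X 0 :=
  (colimit.ι (((homSystem J).obj N).X 0) k).hom ∘ₗ
    (Linear.leftComp R N ((powerResolution J k.unop.unop).π.f 0))

lemma localComplex_map_ι {N N' : ModuleCat.{u} R} (f : N ⟶ N') (k : ℕᵒᵖᵒᵖ) (i : ℕ)
    (x : (powerResolution J k.unop.unop).complex.X i ⟶ N) :
    ((localComplex J).map f).f i ((colimit.ι (((homSystem J).obj N).X i) k).hom x) =
      (colimit.ι (((homSystem J).obj N').X i) k).hom (x ≫ f) :=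
  congrArg (fun g => g.hom x) (ι_colimMap (((homSystem J).map f).f i) k)

lemma localComplex_d_ι (N : ModuleCat.{u} R) (k : ℕᵒᵖᵒᵖ) (i j : ℕ)
    (x : (powerResolution J k.unop.unop).complex.X i ⟶ N) :
    ((localComplex J).obj N).d i j ((colimit.ι (((homSystem J).obj N).X i) k).hom x) =
      (colimit.ι (((homSystem J).obj N).X j) k).hom
        ((powerResolution J k.unop.unop).complex.d j i ≫ x) :=
  congrArg (fun g => g.hom x) (ι_colimMap (((homSystem J).obj N).d i j) k)

lemma localComplex_ι_transition (N : ModuleCat.{u} R) {k l : ℕᵒᵖᵒᵖ} (f : k ⟶ l) (i : ℕ)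
    (x : (powerResolution J k.unop.unop).complex.X i ⟶ N) :
    (colimit.ι (((homSystem J).obj N).X i) l).hom (((resolutionTower J).map f.unop).f i ≫ x) =
      (colimit.ι (((homSystem J).obj N).X i) k).hom x :=
  congrArg (fun g => g.hom x) (colimit.w (((homSystem J).obj N).X i) f)

lemma homClass_comp {N N' : ModuleCat.{u} R} (f : N ⟶ N') (k : ℕᵒᵖᵒᵖ)
    (h : ModuleCat.of R (R ⧸ J ^ k.unop.unop) ⟶ N) :
    ((localComplex J).map f).f 0 (homClass J N k h) = homClass J N' k (h ≫ f) :=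
  (localComplex_map_ι J f k 0 ((powerResolution J k.unop.unop).π.f 0 ≫ h)).trans
    (congrArg (colimit.ι (((homSystem J).obj N').X 0) k).hom (Category.assoc _ _ _))

lemma homClass_transition (N : ModuleCat.{u} R) {k l : ℕᵒᵖᵒᵖ} (f : k ⟶ l)
    (h : ModuleCat.of R (R ⧸ J ^ k.unop.unop) ⟶ N) :
    homClass J N l ((ringModIdeals (idealPowersDiagram J)).map f.unop ≫ h) = homClass J N k h := by
  refine Eq.trans ?_ (localComplex_ι_transition J N f 0
    ((powerResolution J k.unop.unop).π.f 0 ≫ h))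
  refine congrArg (colimit.ι (((homSystem J).obj N).X 0) l).hom ?_
  exact (Category.assoc _ _ _).symm.trans ((congrArg (· ≫ h) (resolutionTower_comm J f.unop).symm).trans
    (Category.assoc _ _ _))

lemma d_homClass (N : ModuleCat.{u} R) (k : ℕᵒᵖᵒᵖ)
    (h : ModuleCat.of R (R ⧸ J ^ k.unop.unop) ⟶ N) :
    ((localComplex J).obj N).d 0 1 (homClass J N k h) = 0 := by
  refine (localComplex_d_ι J N k 0 1 ((powerResolution J k.unop.unop).π.f 0 ≫ h)).trans ?_
  have h0 : (powerResolution J k.unop.unop).complex.d 1 0 ≫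
      (powerResolution J k.unop.unop).π.f 0 ≫ h = 0 := by
    have := (powerResolution J k.unop.unop).complex_d_comp_π_f_zero
    exact (Category.assoc _ _ _).symm.trans ((congrArg (· ≫ h) this).trans zero_comp)
  exact (congrArg (colimit.ι (((homSystem J).obj N).X 1) k).hom h0).trans (map_zero _)

lemma factor_of_d_comp_eq_zero {X N : ModuleCat.{u} R} (P : ProjectiveResolution X)
    (x : P.complex.X 0 ⟶ N) (hx : P.complex.d 1 0 ≫ x = 0) :
    ∃ h : X ⟶ N, P.π.f 0 ≫ h = x :=
  ⟨P.isColimitCokernelCofork.desc (CokernelCofork.ofπ x hx),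
    P.isColimitCokernelCofork.fac (CokernelCofork.ofπ x hx) WalkingParallelPair.one⟩

instance forget_preservesColimitsOfShape_nat :
    PreservesColimitsOfShape ℕᵒᵖᵒᵖ (forget (ModuleCat.{u} R)) :=
  have : PreservesFilteredColimitsOfSize.{0, 0} (forget (ModuleCat.{u} R)) :=
    preservesFilteredColimitsOfSize_shrink.{0, u, 0, u} _
  inferInstance

/-- A cocycle has a representative at some stage `k`. Its coboundary vanishes only in the colimit,
hence at a later stage `l`, where the representative factors through the augmentation. -/
lemma exists_homClass_eq (N : ModuleCat.{u} R) (z : ((localComplex J).obj N).X 0)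
    (hz : ((localComplex J).obj N).d 0 1 z = 0) : ∃ k h, homClass J N k h = z := by
  obtain ⟨k, x', hx'⟩ := Concrete.colimit_exists_rep (((homSystem J).obj N).X 0) z
  obtain ⟨x, rfl⟩ : ∃ x : (powerResolution J k.unop.unop).complex.X 0 ⟶ N, x = x' := ⟨x', rfl⟩
  have hx : (colimit.ι (((homSystem J).obj N).X 0) k).hom x = z := hx'
  have h1 := (localComplex_d_ι J N k 0 1 x).symm.trans
    ((congrArg (((localComplex J).obj N).d 0 1) hx).trans hz)
  have h1' : colimit.ι (((homSystem J).obj N).X 1) k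
      (show (((homSystem J).obj N).X 1).obj k from
        (powerResolution J k.unop.unop).complex.d 1 0 ≫ x) =
      colimit.ι (((homSystem J).obj N).X 1) k 0 := h1.trans (map_zero _).symm
  obtain ⟨l, f, g, hl⟩ := (Concrete.colimit_rep_eq_iff_exists _ _ _).1 h1'
  have h2 : ((resolutionTower J).map f.unop).f 1 ≫
      (powerResolution J k.unop.unop).complex.d 1 0 ≫ x = 0 :=
    hl.trans (map_zero _)
  have h3 : (powerResolution J l.unop.unop).complex.d 1 0 ≫
      ((resolutionTower J).map f.unop).f 0 ≫ x = 0 := by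
    refine (Category.assoc _ _ _).symm.trans (Eq.trans ?_ h2)
    exact (congrArg (· ≫ x) (((resolutionTower J).map f.unop).comm 1 0).symm).trans
      (Category.assoc _ _ _)
  obtain ⟨h, hh⟩ := factor_of_d_comp_eq_zero _ _ h3
  refine ⟨l, h, Eq.trans ?_ hx⟩
  exact (congrArg (colimit.ι (((homSystem J).obj N).X 0) l).hom hh).trans
    (localComplex_ι_transition J N f 0 x)

lemma exists_homClass_eq_localHomologyZeroι (N : ModuleCat.{u} R) (a : (localHomology J 0).obj N) :
    ∃ k h, homClass J N k h = localHomologyZeroι J N a :=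
  exists_homClass_eq J N _ (CochainComplex.d_homologyZeroι ((localComplex J).obj N) a)

lemma exists_localHomologyZeroι_eq_homClass (N : ModuleCat.{u} R) (k : ℕᵒᵖᵒᵖ)
    (h : ModuleCat.of R (R ⧸ J ^ k.unop.unop) ⟶ N) :
    ∃ a, localHomologyZeroι J N a = homClass J N k h :=
  CochainComplex.exists_homologyZeroι_eq ((localComplex J).obj N) _ (d_homClass J N k h)

lemma localHomology_zero_torsion (N : ModuleCat.{u} R) (a : (localHomology J 0).obj N) :
    ∃ k : ℕ, ∀ r ∈ J ^ k, r • a = 0 := by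
  obtain ⟨k, h, hk⟩ := exists_homClass_eq_localHomologyZeroι J N a
  refine ⟨k.unop.unop, fun r hr => localHomologyZeroι_injective J N ?_⟩
  have : r • h = 0 := by
    ext
    change r • h.hom (Ideal.Quotient.mk _ 1) = 0
    rw [← map_smul]
    have : r • (Ideal.Quotient.mk (J ^ k.unop.unop) 1) = 0 := by
      rw [Algebra.smul_def, map_one, mul_one]
      exact Ideal.Quotient.eq_zero_iff_mem.2 hr
    rw [this, map_zero]
  rw [map_smul, ← hk, ← map_smul, this, map_zero, map_zero]

/-- The map `R ⧸ I → N` sending `1` to an element killed by `I`. -/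
def homOfKilled (I : Ideal R) (N : ModuleCat.{u} R) (x : N) (hx : ∀ r ∈ I, r • x = 0) :
    ModuleCat.of R (R ⧸ I) ⟶ N :=
  ModuleCat.ofHom (Submodule.liftQ I (LinearMap.toSpanSingleton R N x) fun r hr => hx r hr)

/-- A map `R ⧸ J ^ k → N'` is an element killed by `J ^ k`. A preimage in `N` is killed by a
possibly higher power, so the map lifts at a later stage. -/
lemma localHomology_zero_map_surjective {N N' : ModuleCat.{u} R} (f : N ⟶ N')
    (hf : Function.Surjective f) (hN : ∀ x : N, ∃ k : ℕ, ∀ r ∈ J ^ k, r • x = 0) :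
    Function.Surjective ((localHomology J 0).map f) := by
  intro a
  obtain ⟨k, h, hk⟩ := exists_homClass_eq_localHomologyZeroι J N' a
  obtain ⟨x, hx⟩ := hf (h.hom (Ideal.Quotient.mk _ 1))
  obtain ⟨n, hn⟩ := hN x
  have hn' : ∀ r ∈ J ^ (max n k.unop.unop), r • x = 0 := fun r hr =>
    hn r (Ideal.pow_le_pow_right (le_max_left _ _) hr)
  let l : ℕᵒᵖᵒᵖ := op (op (max n k.unop.unop))
  let φ : k ⟶ l := (homOfLE (le_max_right n k.unop.unop)).op.op
  obtain ⟨b, hb⟩ := exists_localHomologyZeroι_eq_homClass J N l (homOfKilled _ N x hn')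
  refine ⟨b, localHomologyZeroι_injective J N' ?_⟩
  rw [localHomologyZeroι_naturality, hb, homClass_comp, ← hk, ← homClass_transition J N' φ]
  congr 1
  ext
  change f.hom (LinearMap.toSpanSingleton R N x 1) = h.hom (Ideal.Quotient.mk _ 1)
  rw [LinearMap.toSpanSingleton_apply, one_smul]
  exact hx

lemma localHomology_zero_map_injective {N N' : ModuleCat.{u} R} (f : N ⟶ N')
    (hf : Function.Injective f) : Function.Injective ((localHomology J 0).map f) := by
  have : Mono f := (ModuleCat.mono_iff_injective f).2 hf
  have hS : (ShortComplex.mk f (cokernel.π f) (cokernel.condition f)).ShortExact :=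
    { exact := ShortComplex.exact_cokernel f }
  have : Mono ((localComplex J).map f) := (localComplex_shortExact J hS).mono_f
  have h0 : Function.Injective (((localComplex J).map f).f 0) :=
    (ModuleCat.mono_iff_injective _).1
      (inferInstanceAs (Mono ((HomologicalComplex.eval _ _ 0).map ((localComplex J).map f))))
  intro a b hab
  apply localHomologyZeroι_injective J N
  apply h0
  rw [← localHomologyZeroι_naturality, hab, localHomologyZeroι_naturality]

/-- As `J` kills `N`, every class is already represented at stage 1 by an element of `N`, so `H⁰`
embeds in an image of `N`. -/
lemma isArtinian_localHomology_zero (N : ModuleCat.{u} R) [IsArtinian R N]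
    (hN : ∀ r ∈ J, ∀ x : N, r • x = 0) : IsArtinian R ((localHomology J 0).obj N) := by
  have hN' : ∀ x : N, ∀ r ∈ J ^ 1, r • x = 0 := fun x r hr => hN r (by simpa using hr) x
  let k₁ : ℕᵒᵖᵒᵖ := op (op 1)
  let e : N →ₗ[R] ((localComplex J).obj N).X 0 :=
    { toFun x := homClass J N k₁ (homOfKilled _ N x (hN' x))
      map_add' x y := by
        rw [← map_add]
        congr 1
        ext
        change LinearMap.toSpanSingleton R N (x + y) 1 =
          LinearMap.toSpanSingleton R N x 1 + LinearMap.toSpanSingleton R N y 1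
        simp
      map_smul' r x := by
        rw [RingHom.id_apply, ← map_smul]
        congr 1
        ext
        change LinearMap.toSpanSingleton R N (r • x) 1 = r • LinearMap.toSpanSingleton R N x 1
        simp }
  have he : ∀ a, localHomologyZeroι J N a ∈ LinearMap.range e := by
    intro a
    obtain ⟨k, h, hk⟩ := exists_homClass_eq_localHomologyZeroι J N a
    refine ⟨h.hom (Ideal.Quotient.mk _ 1), ?_⟩
    let l : ℕᵒᵖᵒᵖ := op (op (max 1 k.unop.unop))
    let φ : k ⟶ l := (homOfLE (le_max_right 1 k.unop.unop)).op.op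
    let ψ : k₁ ⟶ l := (homOfLE (le_max_left 1 k.unop.unop)).op.op
    rw [← hk, ← homClass_transition J N φ]
    refine (homClass_transition J N ψ _).symm.trans ?_
    congr 1
    ext
    change LinearMap.toSpanSingleton R N (h.hom (Ideal.Quotient.mk _ 1)) 1 =
      h.hom (Ideal.Quotient.mk _ 1)
    simp
  have := isArtinian_of_surjective N e.rangeRestrict e.surjective_rangeRestrict
  exact isArtinian_of_injective ((localHomologyZeroι J N).codRestrict _ he)
    fun a b hab => localHomologyZeroι_injective J N (congrArg Subtype.val hab)

end localCohomology
end

noncomputable section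

/-! ### Melkersson's criterion for Artinian modules. -/

section Melkersson

variable {R X : Type*} [CommRing R] [AddCommGroup X] [Module R X]

/-- The submodule `x ^ k (N ∩ (0 : x ^ (k + 1)))` of `(0 : x)`. -/
def torsionLayer (x : R) (N : Submodule R X) (k : ℕ) :
    Submodule R (LinearMap.ker (LinearMap.lsmul R X x)) :=
  Submodule.comap (Submodule.subtype _)
    ((N ⊓ LinearMap.ker (LinearMap.lsmul R X (x ^ (k + 1)))).map (LinearMap.lsmul R X (x ^ k)))

lemma mem_torsionLayer {x : R} {N : Submodule R X} {k : ℕ}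
    {z : LinearMap.ker (LinearMap.lsmul R X x)} :
    z ∈ torsionLayer x N k ↔ ∃ y ∈ N, x ^ k • y = z := by
  constructor
  · rintro ⟨y, hy, h⟩
    exact ⟨y, hy.1, h⟩
  · rintro ⟨y, hy, h⟩
    refine ⟨y, ⟨hy, ?_⟩, h⟩
    have hz : x • (z : X) = 0 := z.2
    change x ^ (k + 1) • y = 0
    rw [pow_succ', mul_smul, h, hz]

lemma torsionLayer_mono {x : R} {N N' : Submodule R X} (h : N ≤ N') {k l : ℕ} (hkl : l ≤ k) :
    torsionLayer x N k ≤ torsionLayer x N' l := by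
  intro z hz
  obtain ⟨y, hy, hyz⟩ := mem_torsionLayer.1 hz
  refine mem_torsionLayer.2 ⟨x ^ (k - l) • y, N'.smul_mem _ (h hy), ?_⟩
  rw [← mul_smul, ← pow_add, Nat.add_sub_cancel' hkl, hyz]

/-- Induction on the power of `x` killing `y`: if it is `k + 1`, then `x ^ k • y` lies in `(0 : x)`,
so it equals `x ^ k • y'` with `y' ∈ N'`, and `y - y'` is killed by `x ^ k`. -/
lemma le_of_torsionLayer_le {x : R} (hX : ∀ y : X, ∃ k : ℕ, x ^ k • y = 0) {N N' : Submodule R X}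
    (hN : N' ≤ N) (h : ∀ k, torsionLayer x N k ≤ torsionLayer x N' k) : N ≤ N' := by
  have key : ∀ k : ℕ, ∀ y ∈ N, x ^ k • y = 0 → y ∈ N' := by
    intro k
    induction k with
    | zero =>
      intro y _ h0
      rw [pow_zero, one_smul] at h0
      rw [h0]
      exact N'.zero_mem
    | succ k ih =>
      intro y hy h0
      have hz : x ^ k • y ∈ LinearMap.ker (LinearMap.lsmul R X x) := by
        change x • x ^ k • y = 0
        rw [← mul_smul, ← pow_succ', h0]
      obtain ⟨y', hy', e⟩ := mem_torsionLayer.1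
        (h k (mem_torsionLayer.2 ⟨y, hy, rfl⟩ : (⟨_, hz⟩ : LinearMap.ker _) ∈ _))
      have := ih (y - y') (N.sub_mem hy (hN hy')) (by rw [smul_sub, e, sub_self])
      simpa using N'.add_mem this hy'
  intro y hy
  obtain ⟨k, hk⟩ := hX y
  exact key k y hy hk

/-- Melkersson's criterion: an `x`-torsion module `X` with `(0 :_X x)` Artinian is Artinian. -/
lemma isArtinian_of_isArtinian_ker_smul (x : R) (hX : ∀ y : X, ∃ k : ℕ, x ^ k • y = 0)
    [IsArtinian R (LinearMap.ker (LinearMap.lsmul R X x))] : IsArtinian R X := by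
  rw [← monotone_stabilizes_iff_artinian]
  intro f
  let F : ℕ → Submodule R X := fun n => OrderDual.ofDual (f n)
  have hf : ∀ {m n : ℕ}, m ≤ n → F n ≤ F m := fun h => f.monotone h
  -- The diagonal chain controls all layers `k ≥ n₀` at once; the finitely many layers below `n₀`
  -- stabilise separately.
  obtain ⟨n₀, hn₀⟩ := IsArtinian.monotone_stabilizes (R := R)
    (M := LinearMap.ker (LinearMap.lsmul R X x))
    ⟨fun n => OrderDual.toDual (torsionLayer x (F n) n), fun m n h =>
      OrderDual.toDual_le_toDual.2 (torsionLayer_mono (hf h) h)⟩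
  have hk : ∀ k, ∃ n, ∀ m, n ≤ m → torsionLayer x (F n) k =
      torsionLayer x (F m) k := fun k =>
    IsArtinian.monotone_stabilizes (R := R) (M := LinearMap.ker (LinearMap.lsmul R X x))
      ⟨fun n => OrderDual.toDual (torsionLayer x (F n) k),
        fun m n h => OrderDual.toDual_le_toDual.2 (torsionLayer_mono (hf h) le_rfl)⟩
  choose ν hν using hk
  refine ⟨max n₀ ((Finset.range n₀).sup ν), fun m hm => ?_⟩
  refine le_antisymm (hf hm) ?_
  change (F (max n₀ ((Finset.range n₀).sup ν))) ≤ F m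
  refine le_of_torsionLayer_le hX (hf hm) fun k => ?_
  rcases lt_or_ge k n₀ with hkn | hkn
  · have h1 : ν k ≤ max n₀ ((Finset.range n₀).sup ν) :=
      (Finset.le_sup (f := ν) (Finset.mem_range.2 hkn)).trans (le_max_right _ _)
    rw [← hν k _ h1, hν k _ (h1.trans hm)]
  · calc torsionLayer x (F (max n₀ ((Finset.range n₀).sup ν))) k
        ≤ torsionLayer x (F n₀) n₀ := torsionLayer_mono (hf (le_max_left _ _)) hkn
      _ = torsionLayer x (F (max m k)) (max m k) :=
        hn₀ _ (hkn.trans (le_max_right _ _))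
      _ ≤ _ := torsionLayer_mono (hf (le_max_left _ _)) (le_max_right _ _)

end Melkersson

/-! ### Finiteness of coassociated primes. -/

section Secondary

variable {R X : Type*} [CommRing R] [AddCommGroup X] [Module R X]

/-- Fitting: `W = r^m W + (0 :_W r^m)` for large `m`, so irreducibility makes one summand all of
`W`; for `r ∈ 𝔭` it cannot be the first. Hence `𝔭` depends on `W` alone and not on `N`. -/
lemma mem_iff_of_eq_colon_of_irreducible [IsArtinian R X] {W : Submodule R X}
    (hW : ∀ A B : Submodule R X, A < W → B < W → A ⊔ B ≠ W) {𝔭 : Ideal R} [𝔭.IsPrime]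
    {N : Submodule R X} (h : 𝔭 = N.colon (W : Set X)) (r : R) :
    r ∈ 𝔭 ↔ ∃ n : ℕ, ∀ w ∈ W, r ^ n • w = 0 := by
  have hmem : ∀ s : R, s ∈ 𝔭 ↔ ∀ w ∈ W, s • w ∈ N := fun s => by
    rw [h, Submodule.mem_colon]
    rfl
  constructor
  · intro hr
    obtain ⟨n, hn⟩ := IsArtinian.monotone_stabilizes (R := R) (M := X)
      ⟨fun n => OrderDual.toDual (W.map (LinearMap.lsmul R X (r ^ n))), by
        intro m n hmn
        change W.map (LinearMap.lsmul R X (r ^ n)) ≤ W.map (LinearMap.lsmul R X (r ^ m))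
        rintro _ ⟨w, hw, rfl⟩
        refine ⟨r ^ (n - m) • w, W.smul_mem _ hw, ?_⟩
        simp only [LinearMap.lsmul_apply, smul_smul, ← pow_add, Nat.add_sub_cancel' hmn]⟩
    -- The exponent must be positive, so that `r • W ≤ N` gives `r ^ m • W ≤ N`.
    set m := n + 1 with hm
    have h2 : W.map (LinearMap.lsmul R X (r ^ m)) = W.map (LinearMap.lsmul R X (r ^ (m + m))) :=
      (hn m (by lia)).symm.trans (hn (m + m) (by lia))
    have hA : W.map (LinearMap.lsmul R X (r ^ m)) ≤ W := by
      rintro _ ⟨w, hw, rfl⟩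
      exact W.smul_mem _ hw
    have hAne : W.map (LinearMap.lsmul R X (r ^ m)) ≠ W := by
      intro he
      apply ‹𝔭.IsPrime›.ne_top
      rw [Ideal.eq_top_iff_one, hmem]
      intro w hw
      rw [← he] at hw
      obtain ⟨w', hw', rfl⟩ := hw
      rw [one_smul, LinearMap.lsmul_apply, hm, pow_succ, mul_smul]
      exact N.smul_mem _ ((hmem r).1 hr w' hw')
    have hB : W ⊓ LinearMap.ker (LinearMap.lsmul R X (r ^ m)) ≤ W := inf_le_left
    have hsup : W.map (LinearMap.lsmul R X (r ^ m)) ⊔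
        W ⊓ LinearMap.ker (LinearMap.lsmul R X (r ^ m)) = W := by
      refine le_antisymm (sup_le hA hB) fun w hw => ?_
      have : r ^ m • w ∈ W.map (LinearMap.lsmul R X (r ^ (m + m))) := h2 ▸ ⟨w, hw, rfl⟩
      obtain ⟨w', hw', e⟩ := this
      refine Submodule.mem_sup.2 ⟨r ^ m • w', ⟨w', hw', rfl⟩, w - r ^ m • w',
        ⟨W.sub_mem hw (W.smul_mem _ hw'), ?_⟩, by abel⟩
      change r ^ m • (w - r ^ m • w') = 0
      rw [smul_sub, smul_smul, ← pow_add, sub_eq_zero]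
      exact e.symm
    by_cases hBW : W ⊓ LinearMap.ker (LinearMap.lsmul R X (r ^ m)) = W
    · exact ⟨m, fun w hw => (hBW ▸ hw : w ∈ W ⊓ _).2⟩
    · exact absurd hsup (hW _ _ (lt_of_le_of_ne hA hAne) (lt_of_le_of_ne hB hBW))
  · rintro ⟨n, hn⟩
    refine ‹𝔭.IsPrime›.mem_of_pow_mem n ((hmem _).2 fun w hw => ?_)
    rw [hn w hw]
    exact N.zero_mem

/-- An irreducible `W` contributes at most one prime. If `W = A ⊔ B`, then `N : W` is the
intersection of `N : A` and `N : B`, and a prime that is such an intersection equals one of the two.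
-/
lemma finite_setOf_eq_colon [IsArtinian R X] (W : Submodule R X) :
    {𝔭 : PrimeSpectrum R | ∃ N : Submodule R X, 𝔭.asIdeal = N.colon (W : Set X)}.Finite := by
  induction W using WellFoundedLT.induction with
  | _ W ih =>
    by_cases hW : ∀ A B : Submodule R X, A < W → B < W → A ⊔ B ≠ W
    · refine Set.Subsingleton.finite ?_
      rintro 𝔭 ⟨N, hN⟩ 𝔮 ⟨N', hN'⟩
      ext r
      rw [mem_iff_of_eq_colon_of_irreducible hW hN, mem_iff_of_eq_colon_of_irreducible hW hN']
    · push Not at hW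
      obtain ⟨A, B, hA, hB, rfl⟩ := hW
      refine ((ih A hA).union (ih B hB)).subset ?_
      rintro 𝔭 ⟨N, hN⟩
      have hle : N.colon (A : Set X) ⊓ N.colon (B : Set X) ≤ 𝔭.asIdeal := by
        rintro r ⟨hrA, hrB⟩
        rw [hN, Submodule.mem_colon]
        intro w hw
        obtain ⟨a, ha, b, hb, rfl⟩ := Submodule.mem_sup.1 hw
        rw [smul_add]
        exact N.add_mem (Submodule.mem_colon.1 hrA a ha) (Submodule.mem_colon.1 hrB b hb)
      have hgeA : 𝔭.asIdeal ≤ N.colon (A : Set X) := by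
        intro r hr
        rw [hN] at hr
        exact Submodule.mem_colon.2 fun a ha =>
          Submodule.mem_colon.1 hr a (Submodule.mem_sup_left ha)
      have hgeB : 𝔭.asIdeal ≤ N.colon (B : Set X) := by
        intro r hr
        rw [hN] at hr
        exact Submodule.mem_colon.2 fun a ha =>
          Submodule.mem_colon.1 hr a (Submodule.mem_sup_right ha)
      rcases 𝔭.isPrime.inf_le.1 hle with h | h
      · exact Or.inl ⟨N, le_antisymm hgeA h⟩
      · exact Or.inr ⟨N, le_antisymm hgeB h⟩

/-- The coassociated primes of `X` containing `𝔞` form a finite set if `X ⧸ 𝔞 X` is Artinian. -/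
lemma finite_coassociatedPrimes_inter_zeroLocus (𝔞 : Ideal R)
    [IsArtinian R (X ⧸ (𝔞 • ⊤ : Submodule R X))] :
    (coassociatedPrimes R X ∩ PrimeSpectrum.zeroLocus (𝔞 : Set R)).Finite := by
  refine (finite_setOf_eq_colon (⊤ : Submodule R (X ⧸ (𝔞 • ⊤ : Submodule R X)))).subset ?_
  rintro 𝔭 ⟨⟨N, -, hN⟩, h𝔞⟩
  refine ⟨N.map (Submodule.mkQ _), ?_⟩
  -- Since `𝔭` contains `𝔞`, the module `X ⧸ N` is a quotient of `X ⧸ 𝔞X`, so `𝔭` is a colon ideal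
  -- there.
  have hle : 𝔞 • ⊤ ≤ N := by
    refine Submodule.smul_le.2 fun r hr x _ => ?_
    have : r ∈ Module.annihilator R (X ⧸ N) := hN ▸ h𝔞 hr
    have := Module.mem_annihilator.1 this (Submodule.Quotient.mk x)
    rwa [← Submodule.Quotient.mk_smul, Submodule.Quotient.mk_eq_zero] at this
  ext r
  rw [hN, Module.mem_annihilator, Submodule.mem_colon]
  constructor
  · intro h y _
    obtain ⟨x, rfl⟩ := Submodule.mkQ_surjective _ y
    refine ⟨r • x, ?_, map_smul _ _ _⟩
    have := h (Submodule.Quotient.mk x)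
    rwa [← Submodule.Quotient.mk_smul, Submodule.Quotient.mk_eq_zero] at this
  · intro h y
    obtain ⟨x, rfl⟩ := Submodule.mkQ_surjective _ y
    obtain ⟨x', hx', e⟩ := h (Submodule.mkQ _ x) trivial
    rw [← map_smul] at e ⊢
    have hd : x' - r • x ∈ (𝔞 • ⊤ : Submodule R X) := (Submodule.Quotient.eq _).1 e
    rw [Submodule.mkQ_apply, Submodule.Quotient.mk_eq_zero]
    have := N.sub_mem hx' (hle hd)
    simpa using this

end Secondary

/-! ### Artinian quotients along exact sequences; regular elements. -/

section

variable {R : Type*} [CommRing R] [IsNoetherianRing R] {X B A : Type*} [AddCommGroup X] [Module R X]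
  [AddCommGroup B] [Module R B] [AddCommGroup A] [Module R A]

/-- Generators `s₁, …, sₙ` of `𝔞` give a map from `(B ⧸ K)ⁿ` onto `𝔞B ⧸ 𝔞K`, so `B ⧸ 𝔞K` is an
extension of `B ⧸ 𝔞B` by an Artinian module. -/
lemma isArtinian_quotient_smul (𝔞 : Ideal R) (K : Submodule R B) [IsArtinian R (B ⧸ K)]
    [IsArtinian R (B ⧸ (𝔞 • ⊤ : Submodule R B))] : IsArtinian R (B ⧸ 𝔞 • K) := by
  obtain ⟨n, s, hs⟩ := Submodule.fg_iff_exists_fin_generating_family.1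
    ((isNoetherianRing_iff_ideal_fg R).1 ‹_› 𝔞)
  have hs𝔞 : ∀ i, s i ∈ 𝔞 := fun i => hs ▸ Submodule.subset_span ⟨i, rfl⟩
  let φ : Fin n → (B ⧸ K) →ₗ[R] B ⧸ 𝔞 • K := fun i =>
    Submodule.mapQ K (𝔞 • K) (LinearMap.lsmul R B (s i)) fun x hx =>
      Submodule.smul_mem_smul (hs𝔞 i) hx
  let f : (Fin n → B ⧸ K) →ₗ[R] B ⧸ 𝔞 • K := ∑ i, φ i ∘ₗ LinearMap.proj i
  let g : B ⧸ 𝔞 • K →ₗ[R] B ⧸ (𝔞 • ⊤ : Submodule R B) :=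
    Submodule.factor (Submodule.smul_mono le_rfl le_top)
  have hf : ∀ (i : Fin n) (x : B), f (Pi.single i (Submodule.Quotient.mk x)) =
      Submodule.Quotient.mk (s i • x) := by
    intro i x
    simp only [f, LinearMap.sum_apply, LinearMap.comp_apply, LinearMap.proj_apply]
    rw [Finset.sum_eq_single i]
    · rw [Pi.single_eq_same]
      rfl
    · intro j _ hj
      rw [Pi.single_eq_of_ne hj, map_zero]
    · simp
  refine isArtinian_of_range_eq_ker f g (le_antisymm ?_ ?_)
  · rintro _ ⟨y, rfl⟩
    rw [LinearMap.mem_ker]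
    simp only [f, LinearMap.sum_apply, LinearMap.comp_apply, LinearMap.proj_apply, map_sum]
    refine Finset.sum_eq_zero fun i _ => ?_
    obtain ⟨x, hx⟩ := Submodule.Quotient.mk_surjective _ (y i)
    rw [← hx]
    change Submodule.Quotient.mk (s i • x) = (0 : B ⧸ (𝔞 • ⊤ : Submodule R B))
    rw [Submodule.Quotient.mk_eq_zero]
    exact Submodule.smul_mem_smul (hs𝔞 i) trivial
  · intro y hy
    obtain ⟨x, rfl⟩ := Submodule.Quotient.mk_surjective _ y
    have hx : x ∈ (𝔞 • ⊤ : Submodule R B) := (Submodule.Quotient.mk_eq_zero _).1 hy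
    have hle : (𝔞 • ⊤ : Submodule R B) ≤ (LinearMap.range f).comap (Submodule.mkQ _) := by
      refine Submodule.smul_le.2 fun r hr b _ => ?_
      rw [← hs] at hr
      induction hr using Submodule.span_induction with
      | mem r hr =>
        obtain ⟨i, rfl⟩ := hr
        exact ⟨_, hf i b⟩
      | zero => rw [zero_smul]; exact Submodule.zero_mem _
      | add r r' _ _ h h' => rw [add_smul]; exact Submodule.add_mem _ h h'
      | smul c r _ h => rw [smul_assoc]; exact Submodule.smul_mem _ _ h
    exact hle hx

/-- With `K` the range of `g`, the induced map `X ⧸ 𝔞X → B ⧸ 𝔞K` has Artinian target, and its kernel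
is the image of `A`. -/
lemma isArtinian_quotient_smul_top_of_exact (𝔞 : Ideal R) (f : A →ₗ[R] X) (g : X →ₗ[R] B)
    [IsArtinian R A] (hfg : ∀ a, g (f a) = 0)
    (hg : LinearMap.ker g ≤ LinearMap.range f ⊔ 𝔞 • ⊤) [IsArtinian R (B ⧸ LinearMap.range g)]
    [IsArtinian R (B ⧸ (𝔞 • ⊤ : Submodule R B))] :
    IsArtinian R (X ⧸ (𝔞 • ⊤ : Submodule R X)) := by
  have := isArtinian_quotient_smul 𝔞 (LinearMap.range g)
  have hmap : (𝔞 • ⊤ : Submodule R X).map g = 𝔞 • LinearMap.range g := by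
    rw [Submodule.map_smul'', LinearMap.range_eq_map]
  refine isArtinian_of_range_eq_ker ((Submodule.mkQ _) ∘ₗ f)
    (Submodule.mapQ (𝔞 • ⊤) (𝔞 • LinearMap.range g) g (Submodule.map_le_iff_le_comap.1 hmap.le))
    (le_antisymm ?_ ?_)
  · rintro _ ⟨a, rfl⟩
    simp [hfg]
  · intro y hy
    obtain ⟨x, rfl⟩ := Submodule.Quotient.mk_surjective _ y
    have hx : g x ∈ 𝔞 • LinearMap.range g := (Submodule.Quotient.mk_eq_zero _).1 hy
    rw [← hmap] at hx
    obtain ⟨x', hx', e⟩ := hx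
    have hd : x - x' ∈ LinearMap.range f ⊔ 𝔞 • ⊤ := hg (by simp [e])
    obtain ⟨_, ⟨a, rfl⟩, z, hz, e'⟩ := Submodule.mem_sup.1 hd
    refine ⟨a, (Submodule.Quotient.eq _).2 ?_⟩
    have : f a - x = -(z + x') := by
      rw [eq_sub_iff_add_eq] at e'
      rw [← e']
      abel
    rw [this]
    exact Submodule.neg_mem _ (Submodule.add_mem _ hz hx')

/-- If no nonzero element of a finite module is killed by `𝔞`, then `𝔞` contains a regular element.
-/
lemma exists_mem_isSMulRegular [Module.Finite R X] (𝔞 : Ideal R)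
    (h : ∀ q : X, (∀ r ∈ 𝔞, r • q = 0) → q = 0) :
    ∃ x ∈ 𝔞, Function.Injective (LinearMap.lsmul R X x) := by
  by_contra! hc
  have hsub : (𝔞 : Set R) ⊆ ⋃ p ∈ associatedPrimes R X, ((p : Ideal R) : Set R) := by
    rw [biUnion_associatedPrimes_eq_zero_divisors]
    intro x hx
    have := hc x hx
    rw [← LinearMap.ker_eq_bot, ← ne_eq, Submodule.ne_bot_iff] at this
    obtain ⟨q, hq, hq0⟩ := this
    exact ⟨q, hq0, hq⟩
  -- Prime avoidance: if `𝔞` consists of zero divisors, it lies in one associated prime, the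
  -- annihilator of some `q`, which `𝔞` then kills.
  obtain ⟨p, hp, hle⟩ := (Ideal.subset_union_prime_finite (f := fun p : Ideal R => p)
    (associatedPrimes.finite R X) ⊥ ⊥ fun p hp _ _ => hp.isPrime).1 hsub
  obtain ⟨hprime, q, hq⟩ := isAssociatedPrime_iff.1 hp
  have hq0 : q = 0 := h q fun r hr => by
    simpa [hq, Submodule.mem_colon] using hle hr
  exact hprime.ne_top (by simp [hq, hq0, Ideal.eq_top_iff_one, Submodule.mem_colon])

end
end

/-! ### Torsion modules and Artinianness of local cohomology. -/

noncomputable section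

variable {R : Type u} [CommRing R]

/-- The elements of a module killed by a power of `J`. -/
def powTorsion (J : Ideal R) (X : Type*) [AddCommGroup X] [Module R X] : Submodule R X where
  carrier := {x | ∃ k : ℕ, ∀ r ∈ J ^ k, r • x = 0}
  zero_mem' := ⟨0, fun r _ => smul_zero r⟩
  add_mem' := by
    rintro x y ⟨k, hk⟩ ⟨l, hl⟩
    refine ⟨max k l, fun r hr => ?_⟩
    rw [smul_add, hk r (Ideal.pow_le_pow_right (le_max_left k l) hr),
      hl r (Ideal.pow_le_pow_right (le_max_right k l) hr), add_zero]
  smul_mem' := by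
    rintro c x ⟨k, hk⟩
    exact ⟨k, fun r hr => by rw [smul_comm, hk r hr, smul_zero]⟩

lemma exists_pow_smul_eq_zero_of_fg (J : Ideal R) {X : Type*} [AddCommGroup X] [Module R X]
    [Module.Finite R X] (hX : ∀ x : X, ∃ k : ℕ, ∀ r ∈ J ^ k, r • x = 0) :
    ∃ k : ℕ, ∀ r ∈ J ^ k, ∀ x : X, r • x = 0 := by
  obtain ⟨n, s, hs⟩ := Module.Finite.exists_fin (R := R) (M := X)
  choose κ hκ using fun i => hX (s i)
  refine ⟨Finset.univ.sup κ, fun r hr x => ?_⟩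
  have hx : x ∈ Submodule.span R (Set.range s) := hs ▸ Submodule.mem_top
  induction hx using Submodule.span_induction with
  | mem x hx =>
    obtain ⟨i, rfl⟩ := hx
    exact hκ i r (Ideal.pow_le_pow_right (Finset.le_sup (Finset.mem_univ i)) hr)
  | zero => exact smul_zero r
  | add x y _ _ hx hy => rw [smul_add, hx, hy, add_zero]
  | smul c x _ hx => rw [smul_comm, hx, smul_zero]

/-- The `J`-torsion submodule of an injective module over a Noetherian ring is injective. -/
lemma injective_powTorsion [IsNoetherianRing R] (J : Ideal R) (E : Type u) [AddCommGroup E]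
    [Module R E] [Module.Injective R E] : Module.Injective R (powTorsion J E) := by
  refine Module.Baer.injective fun I g => ?_
  obtain ⟨c, hc⟩ : ∃ c : ℕ, ∀ r ∈ J ^ c, ∀ x : LinearMap.range g, r • x = 0 := by
    have := Module.Finite.range g
    have hx : ∀ x : LinearMap.range g, ∃ k : ℕ, ∀ r ∈ J ^ k, r • x = 0 := fun x => ?_
    · obtain ⟨c, hc⟩ := exists_pow_smul_eq_zero_of_fg J (X := LinearMap.range g) hx
      exact ⟨c, fun r hr x => hc r hr x⟩
    obtain ⟨k, hk⟩ := x.1.2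
    exact ⟨k, fun r hr => Subtype.ext (Subtype.ext (hk r hr))⟩
  have hc' : ∀ r ∈ J ^ c, ∀ x : I, r • g x = 0 := fun r hr x =>
    congrArg Subtype.val (hc r hr ⟨g x, x, rfl⟩)
  -- Artin–Rees puts `J ^ (k + c) ∩ I` inside `J ^ c I`, where `g` vanishes. So `g` factors through
  -- the image of `I` in `R ⧸ J ^ (k + c)`, and an extension from there to `E` has torsion values.
  obtain ⟨k, hk⟩ := J.exists_pow_inf_eq_pow_smul (M := R) I
  have hker : ∀ x : I, (x : R) ∈ J ^ (k + c) → g x = 0 := by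
    intro x hx
    have hx' : (x : R) ∈ (J ^ c • I : Submodule R R) := by
      have h1 : (x : R) ∈ (J ^ (k + c) • ⊤ ⊓ I : Submodule R R) := ⟨by simpa using hx, x.2⟩
      rw [hk (k + c) (Nat.le_add_right k c), Nat.add_sub_cancel_left] at h1
      exact Submodule.smul_mono le_rfl inf_le_right h1
    have hle : (J ^ c • I : Submodule R R) ≤ (LinearMap.ker g).map (Submodule.subtype I) := by
      refine Submodule.smul_le.2 fun r hr y hy => ⟨r • ⟨y, hy⟩, ?_, rfl⟩
      change g (r • ⟨y, hy⟩) = 0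
      rw [map_smul, hc' r hr]
    obtain ⟨y, hy, e⟩ := hle hx'
    rw [← Subtype.ext e]
    exact hy
  let I₀ : Submodule R I := Submodule.comap (Submodule.subtype I) (J ^ (k + c) : Ideal R)
  let f : (I ⧸ I₀) →ₗ[R] R ⧸ J ^ (k + c) :=
    Submodule.mapQ I₀ (J ^ (k + c) : Ideal R) (Submodule.subtype I) le_rfl
  have hf : Function.Injective f := by
    rw [injective_iff_map_eq_zero]
    intro y hy
    obtain ⟨x, rfl⟩ := Submodule.Quotient.mk_surjective _ y
    exact (Submodule.Quotient.mk_eq_zero I₀).2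
      ((Submodule.Quotient.mk_eq_zero (J ^ (k + c) : Ideal R)).1 hy)
  let g' : (I ⧸ I₀) →ₗ[R] E :=
    Submodule.liftQ I₀ ((powTorsion J E).subtype ∘ₗ g) fun x hx => congrArg Subtype.val (hker x hx)
  obtain ⟨h, hh⟩ := Module.Injective.out f hf g'
  refine ⟨LinearMap.codRestrict _ (h ∘ₗ Submodule.mkQ _) fun r => ⟨k + c, fun s hs => ?_⟩,
    fun x hx => Subtype.ext (hh (Submodule.Quotient.mk ⟨x, hx⟩))⟩
  rw [← map_smul, LinearMap.comp_apply, Submodule.mkQ_apply,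
    (Submodule.Quotient.mk_eq_zero (J ^ (k + c) : Ideal R)).2, map_zero]
  exact Ideal.mul_mem_right _ _ hs

/-- Induction over the proper quotients of a finite module over a Noetherian ring. -/
lemma Module.Finite.induction_on_quotients [IsNoetherianRing R]
    {P : ∀ (Q : Type u) [AddCommGroup Q] [Module R Q], Prop}
    (h : ∀ (Q : Type u) [AddCommGroup Q] [Module R Q] [Module.Finite R Q],
      (∀ V : Submodule R Q, V ≠ ⊥ → P (Q ⧸ V)) → P Q)
    (N : Type u) [AddCommGroup N] [Module R N] [Module.Finite R N] : P N := by
  -- The induction runs over kernels in the fixed module `N`, as the quotients are different types.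
  have key : ∀ (U : Submodule R N) (Q : Type u) [AddCommGroup Q] [Module R Q] (f : N →ₗ[R] Q),
      Function.Surjective f → LinearMap.ker f = U → P Q := by
    intro U
    induction U using WellFoundedGT.induction with
    | _ U ih =>
      intro Q _ _ f hf hU
      have := Module.Finite.of_surjective f hf
      refine h Q fun V hV => ?_
      refine ih (LinearMap.ker (V.mkQ ∘ₗ f)) ?_ (Q ⧸ V) (V.mkQ ∘ₗ f)
        (V.mkQ_surjective.comp hf) rfl
      rw [← hU]
      refine lt_of_le_of_ne (LinearMap.ker_le_ker_comp f V.mkQ) fun he => hV ?_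
      rw [eq_bot_iff]
      intro v hv
      obtain ⟨n, rfl⟩ := hf v
      have : n ∈ LinearMap.ker (V.mkQ ∘ₗ f) := by simpa using hv
      rw [← he] at this
      exact this
  exact key ⊥ N LinearMap.id Function.surjective_id LinearMap.ker_id

namespace localCohomology

/-- The short complex `X → Y → Y ⧸ X` given by an injective linear map. -/
def quotientShortComplex {X Y : ModuleCat.{u} R} (f : X ⟶ Y) : ShortComplex (ModuleCat.{u} R) :=
  ShortComplex.mk f (ModuleCat.ofHom (LinearMap.range f.hom).mkQ) (by
    ext x
    exact (Submodule.Quotient.mk_eq_zero _).2 ⟨x, rfl⟩)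

lemma quotientShortComplex_shortExact {X Y : ModuleCat.{u} R} (f : X ⟶ Y)
    (hf : Function.Injective f) : (quotientShortComplex f).ShortExact :=
  ModuleCat.shortComplex_shortExact _
    (fun _ => Submodule.Quotient.mk_eq_zero _) hf (Submodule.mkQ_surjective _)

variable (J : Ideal R)

lemma localδ_surjective_of_subsingleton {S : ShortComplex (ModuleCat.{u} R)} (hS : S.ShortExact)
    (i : ℕ) [Subsingleton ((localHomology J (i + 1)).obj S.X₂)] :
    Function.Surjective (localδ (J := J) hS i) := fun a =>
  (localHomology_exact₁ hS i a).1 (Subsingleton.elim _ _)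

/-- Local cohomology modules are torsion. -/
lemma localHomology_torsion (N : ModuleCat.{u} R) (i : ℕ) (a : (localHomology J i).obj N) :
    ∃ k : ℕ, ∀ r ∈ J ^ k, r • a = 0 := by
  induction i generalizing N with
  | zero => exact localHomology_zero_torsion J N a
  | succ i ih =>
    -- Dimension shifting: embedding `N` in an injective makes `H^{i+1}(N)` a quotient of `H^i` of
    -- the cokernel.
    have hS := quotientShortComplex_shortExact (Injective.ι N)
      ((ModuleCat.mono_iff_injective _).1 inferInstance)
    have : Subsingleton ((localHomology J (i + 1)).obj
        (quotientShortComplex (Injective.ι N)).X₂) :=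
      localHomology_subsingleton_of_injective J (Injective.under N) i
    obtain ⟨b, rfl⟩ := localδ_surjective_of_subsingleton J hS i a
    obtain ⟨k, hk⟩ := ih _ b
    refine ⟨k, fun r hr => ?_⟩
    exact (map_smul (localδ (J := J) hS i).hom r b).symm.trans
      ((congrArg _ (hk r hr)).trans (map_zero _))

/-- The higher local cohomology of torsion modules vanishes. -/
lemma localHomology_subsingleton_of_torsion [IsNoetherianRing R] (T : ModuleCat.{u} R)
    (hT : ∀ x : T, ∃ k : ℕ, ∀ r ∈ J ^ k, r • x = 0) (i : ℕ) :
    Subsingleton ((localHomology J (i + 1)).obj T) := by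
  induction i using Nat.strong_induction_on generalizing T with
  | _ i ih =>
  let E : ModuleCat.{u} R := Injective.under T
  have : Module.Injective R E := (Module.injective_iff_injective_object R E).2 (inferInstanceAs (Injective (Injective.under T)))
  -- The torsion part of `E` is still injective and contains `T`; unlike `E` itself, it has a
  -- torsion cokernel, so the induction continues.
  let E' : ModuleCat.{u} R := ModuleCat.of R (powTorsion J E)
  have hE' : Injective E' :=
    (Module.injective_iff_injective_object R _).1 (injective_powTorsion J E)
  have hι : Function.Injective (Injective.ι T) := (ModuleCat.mono_iff_injective _).1 inferInstance
  have hmem : ∀ x : T, Injective.ι T x ∈ powTorsion J E := fun x => by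
    obtain ⟨k, hk⟩ := hT x
    exact ⟨k, fun r hr => by rw [← map_smul, hk r hr, map_zero]⟩
  let f : T ⟶ E' := ModuleCat.ofHom (LinearMap.codRestrict _ (Injective.ι T).hom hmem)
  have hf : Function.Injective f := fun x y hxy => hι (congrArg Subtype.val hxy)
  have hS := quotientShortComplex_shortExact f hf
  have hE'tors : ∀ x : E', ∃ k : ℕ, ∀ r ∈ J ^ k, r • x = 0 := fun x => by
    obtain ⟨k, hk⟩ := x.2
    exact ⟨k, fun r hr => Subtype.ext (hk r hr)⟩
  have hsurj : Function.Surjective (localδ (J := J) hS i) :=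
    have : Subsingleton ((localHomology J (i + 1)).obj (quotientShortComplex f).X₂) :=
      localHomology_subsingleton_of_injective J E' i
    localδ_surjective_of_subsingleton J hS i
  cases i with
  | zero =>
    -- `H⁰` is right exact here, so the connecting map is both zero and onto.
    have hg := localHomology_zero_map_surjective J (quotientShortComplex f).g
      (Submodule.mkQ_surjective _) hE'tors
    refine subsingleton_of_forall_eq 0 fun a => ?_
    obtain ⟨b, rfl⟩ := hsurj a
    exact (localHomology_exact₃ hS 0 b).2 (hg b)
  | succ i =>
    have : Subsingleton ((localHomology J (i + 1)).obj (quotientShortComplex f).X₃) := by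
      refine ih i i.lt_succ_self _ fun x => ?_
      obtain ⟨y, rfl⟩ := Submodule.mkQ_surjective _ x
      obtain ⟨k, hk⟩ := hE'tors y
      exact ⟨k, fun r hr => (map_smul (Submodule.mkQ _) r y).symm.trans
        ((congrArg _ (hk r hr)).trans (map_zero _))⟩
    exact hsurj.subsingleton

lemma isArtinian_span_singleton [J.IsMaximal] {N : Type*} [AddCommGroup N] [Module R N] (q : N)
    (hq : ∀ r ∈ J, r • q = 0) : IsArtinian R (Submodule.span R {q}) := by
  have : IsSimpleModule R (R ⧸ J) :=
    isSimpleModule_iff_isCoatom.2 (Ideal.isMaximal_def.1 inferInstance)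
  let f : (R ⧸ J) →ₗ[R] Submodule.span R {q} := Submodule.liftQ J
    (LinearMap.toSpanSingleton R _ ⟨q, Submodule.mem_span_singleton_self q⟩)
    fun r hr => Subtype.ext (hq r hr)
  refine isArtinian_of_surjective _ f ?_
  rintro ⟨y, hy⟩
  obtain ⟨r, rfl⟩ := Submodule.mem_span_singleton.1 hy
  exact ⟨Submodule.Quotient.mk r, rfl⟩

lemma isArtinian_localHomology_of_mem_ker {S : ShortComplex (ModuleCat.{u} R)} (hS : S.ShortExact)
    (i : ℕ) [IsArtinian R ((localHomology J i).obj S.X₁)]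
    [IsArtinian R ((localHomology J i).obj S.X₃)] : IsArtinian R ((localHomology J i).obj S.X₂) :=
  isArtinian_of_range_eq_ker ((localHomology J i).map S.f).hom ((localHomology J i).map S.g).hom
    (LinearMap.exact_iff.1 (localHomology_exact₂ hS i)).symm

lemma smul_localHomology (N : ModuleCat.{u} R) (r : R) (i : ℕ) (a : (localHomology J i).obj N) :
    (localHomology J i).map (r • 𝟙 N) a = r • a := by
  rw [localHomology_map_smul, CategoryTheory.Functor.map_id]
  rfl

/-- By Melkersson's criterion only the kernel of `x` on `H^i(Q)` matters: it is zero for `i = 0`,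
and otherwise the image of `H^{i-1}(Q/xQ)`. -/
lemma isArtinian_localHomology_of_injective_smul {Q : ModuleCat.{u} R} {x : R} (hxJ : x ∈ J)
    (hx : Function.Injective (x • 𝟙 Q)) (i : ℕ)
    (h : ∀ j, i = j + 1 → IsArtinian R ((localHomology J j).obj
      (quotientShortComplex (x • 𝟙 Q)).X₃)) :
    IsArtinian R ((localHomology J i).obj Q) := by
  have htors : ∀ a : (localHomology J i).obj Q, ∃ k : ℕ, x ^ k • a = 0 := fun a => by
    obtain ⟨k, hk⟩ := localHomology_torsion J _ i a
    exact ⟨k, hk _ (Ideal.pow_mem_pow hxJ k)⟩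
  refine @isArtinian_of_isArtinian_ker_smul R _ _ _ _ x htors ?_
  cases i with
  | zero =>
    have : LinearMap.ker (LinearMap.lsmul R ((localHomology J 0).obj Q) x) = ⊥ := by
      refine LinearMap.ker_eq_bot.2 fun a b hab => ?_
      refine localHomology_zero_map_injective J (x • 𝟙 Q) hx ?_
      rw [smul_localHomology, smul_localHomology]
      exact hab
    rw [this]
    infer_instance
  | succ i =>
    have hS := quotientShortComplex_shortExact (x • 𝟙 Q) hx
    have hA := h i rfl
    let d : (localHomology J i).obj (quotientShortComplex (x • 𝟙 Q)).X₃ →ₗ[R]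
        (localHomology J (i + 1)).obj Q := (localδ (J := J) hS i).hom
    have hker : LinearMap.ker (LinearMap.lsmul R ((localHomology J (i + 1)).obj Q) x) =
        LinearMap.range d := by
      ext a
      refine Iff.trans ?_ (localHomology_exact₁ hS i a)
      refine Eq.congr_left (Eq.symm ?_)
      exact smul_localHomology J Q x (i + 1) a
    rw [hker]
    exact isArtinian_of_surjective _ d.rangeRestrict
      (LinearMap.surjective_rangeRestrict _)

/-- The inclusion of the submodule generated by an element. -/
abbrev spanInclusion {Q : ModuleCat.{u} R} (q : Q) :
    ModuleCat.of R (Submodule.span R {q}) ⟶ Q :=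
  ModuleCat.ofHom (Submodule.subtype _)

lemma smul_span_singleton_eq_zero {N : Type*} [AddCommGroup N] [Module R N] {q : N}
    (hq : ∀ r ∈ J, r • q = 0) (r : R) (hr : r ∈ J) (y : Submodule.span R {q}) : r • y = 0 := by
  obtain ⟨y, hy⟩ := y
  obtain ⟨s, rfl⟩ := Submodule.mem_span_singleton.1 hy
  exact Subtype.ext ((smul_comm r s q).trans (by rw [hq r hr, smul_zero]; rfl))

lemma isArtinian_localHomology_span_singleton [IsNoetherianRing R] [J.IsMaximal]
    {N : Type u} [AddCommGroup N] [Module R N] {q : N} (hq : ∀ r ∈ J, r • q = 0) (i : ℕ) :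
    IsArtinian R ((localHomology J i).obj (ModuleCat.of R (Submodule.span R {q}))) := by
  cases i with
  | zero =>
    have := isArtinian_span_singleton J q hq
    exact isArtinian_localHomology_zero J _ (smul_span_singleton_eq_zero J hq)
  | succ i =>
    have : Subsingleton ((localHomology J (i + 1)).obj
        (ModuleCat.of R (Submodule.span R {q}))) :=
      localHomology_subsingleton_of_torsion J _
        (fun y => ⟨1, fun r hr => smul_span_singleton_eq_zero J hq r (by simpa using hr) y⟩) i
    infer_instance

/-- The local cohomology of a finite module with support in a maximal ideal is Artinian. -/
lemma isArtinian_localHomology [IsNoetherianRing R] [J.IsMaximal] (i : ℕ) (N : Type u)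
    [AddCommGroup N] [Module R N] [Module.Finite R N] :
    IsArtinian R ((localHomology J i).obj (ModuleCat.of R N)) := by
  induction i using Nat.strong_induction_on generalizing N with
  | _ i ihi =>
  have key := @Module.Finite.induction_on_quotients R _ _
    (fun Q _ _ => IsArtinian R ((localHomology J i).obj (ModuleCat.of R Q)))
  refine key (fun Q _ _ _ ih => ?_) N
  -- Either `J` contains a `Q`-regular element and the degree drops, or `Q` contains a simple
  -- submodule `Rq` and passes to a proper quotient.
  by_cases hq : ∀ q : Q, (∀ r ∈ J, r • q = 0) → q = 0
  · obtain ⟨x, hxJ, hx⟩ := exists_mem_isSMulRegular J hq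
    refine isArtinian_localHomology_of_injective_smul J hxJ hx i fun j hj => ?_
    exact ihi j (by lia) _
  · push Not at hq
    obtain ⟨q, hqJ, hq0⟩ := hq
    have hS := quotientShortComplex_shortExact (spanInclusion (Q := ModuleCat.of R Q) q)
      (Submodule.subtype_injective _)
    have hV : LinearMap.range (spanInclusion (Q := ModuleCat.of R Q) q).hom ≠ ⊥ := by
      rw [Submodule.ne_bot_iff]
      exact ⟨q, ⟨⟨q, Submodule.mem_span_singleton_self q⟩, rfl⟩, hq0⟩
    have h₃ : IsArtinian R ((localHomology J i).obj
      (quotientShortComplex (spanInclusion (Q := ModuleCat.of R Q) q)).X₃) := ih _ hV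
    have h₁ : IsArtinian R ((localHomology J i).obj
        (quotientShortComplex (spanInclusion (Q := ModuleCat.of R Q) q)).X₁) :=
      isArtinian_localHomology_span_singleton J hqJ i
    exact isArtinian_localHomology_of_mem_ker J hS i

end localCohomology
end

/-! ### Exactness of sequential limits. -/

noncomputable section

namespace ModuleCat

variable {R : Type u} [CommRing R]

lemma limit_elem_ext (T : ℕᵒᵖ ⥤ ModuleCat.{u} R) (x y : (limit T : ModuleCat R))
    (h : ∀ j, limit.π T j x = limit.π T j y) : x = y :=
  Concrete.limit_ext T x y h

lemma exists_limit_elem (T : ℕᵒᵖ ⥤ ModuleCat.{u} R) (x : ∀ j, T.obj j)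
    (hx : ∀ ⦃j j' : ℕᵒᵖ⦄ (f : j ⟶ j'), T.map f (x j) = x j') :
    ∃ y : (limit T : ModuleCat R), ∀ j, limit.π T j y = x j := by
  let c : Cone T :=
    { pt := ModuleCat.of R R
      π := { app := fun j => ModuleCat.ofHom (LinearMap.toSpanSingleton R (T.obj j) (x j))
             naturality := fun j j' f => by
              ext
              simp [hx f] } }
  refine ⟨limit.lift T c 1, fun j => ?_⟩
  have h : limit.lift T c ≫ limit.π T j = c.π.app j := limit.lift_π c j
  refine (congrArg (fun g => g.hom 1) h).trans ?_
  simp [c]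

end ModuleCat

lemma CategoryTheory.Functor.IsMittagLeffler.nonempty_sections {F : ℕᵒᵖ ⥤ Type u}
    (h : F.IsMittagLeffler) [∀ j, Nonempty (F.obj j)] : Nonempty F.sections := by
  have hne := F.toEventualRanges_nonempty h
  have hsurj := F.surjective_toEventualRanges h
  obtain ⟨x⟩ := hne (op 0)
  obtain ⟨y, -⟩ := Concrete.surjective_π_app_zero_of_surjective_map
    (limit.isLimit F.toEventualRanges) (fun n => hsurj _) x
  exact ⟨F.toEventualRangesSectionsEquiv ((Types.limitEquivSections F.toEventualRanges) y)⟩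

section

variable {R : Type u} [CommRing R] {A B C : ℕᵒᵖ ⥤ ModuleCat.{u} R}

open ModuleCat

/-- The inverse system of fibres of `α : A ⟶ B` over an element of the limit of `B`. -/
def fibreSystem (α : A ⟶ B) (b : (limit B : ModuleCat R)) : ℕᵒᵖ ⥤ Type u where
  obj j := {a : A.obj j // α.app j a = limit.π B j b}
  map {j j'} f := ↾fun a => ⟨A.map f a.1, by
    rw [NatTrans.naturality_apply, a.2, limit.w_apply]⟩
  map_id j := by
    ext a
    simp
  map_comp f g := by
    ext a
    simp

/-- The images in `A.obj j` of the later fibres are nested cosets of the images `D n` of kernels.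
The Artinian condition makes `D` stationary, and nested cosets of one submodule coincide. -/
lemma fibreSystem_isMittagLeffler (α : A ⟶ B) (b : (limit B : ModuleCat R))
    [∀ j, IsArtinian R (A.obj j)] (hne : ∀ j, Nonempty ((fibreSystem α b).obj j)) :
    (fibreSystem α b).IsMittagLeffler := by
  intro j
  let i (n : ℕ) : ℕᵒᵖ := op (j.unop + n)
  let f (n : ℕ) : i n ⟶ j := (homOfLE (Nat.le_add_right j.unop n)).op
  let t {n n' : ℕ} (h : n ≤ n') : i n' ⟶ i n := (homOfLE (Nat.add_le_add_left h j.unop)).op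
  have htf : ∀ {n n' : ℕ} (h : n ≤ n') (a : A.obj (i n')),
      A.map (f n) (A.map (t h) a) = A.map (f n') a := fun h a => by
    rw [← ConcreteCategory.comp_apply, ← Functor.map_comp]
    rfl
  let D : ℕ → Submodule R (A.obj j) := fun n =>
    (LinearMap.ker (α.app (i n)).hom).map (A.map (f n)).hom
  have hD : Antitone D := by
    rintro n n' h _ ⟨a, ha, rfl⟩
    refine ⟨A.map (t h) a, ?_, htf h a⟩
    change α.app _ (A.map _ a) = 0
    rw [NatTrans.naturality_apply]
    exact (congrArg _ ha).trans (map_zero _)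
  obtain ⟨n, hn⟩ := IsArtinian.monotone_stabilizes (R := R) (M := A.obj j)
    ⟨fun n => OrderDual.toDual (D n), fun m m' h => OrderDual.toDual_le_toDual.2 (hD h)⟩
  refine ⟨i n, f n, fun k g => ?_⟩
  rintro _ ⟨x, rfl⟩
  have hx := x.2
  set l := max n k.unop
  have hl : D n = D l := hn l (le_max_left _ _)
  obtain ⟨y⟩ := hne (i l)
  have hy := y.2
  -- The images of `y` and `x` differ by an element of `D n = D l`, so a correction of `y` by an
  -- element of the kernel at stage `l` reaches the image of `x`.
  have hd : A.map (f l) y.1 - A.map (f n) x.1 ∈ D n := by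
    refine ⟨A.map (t (le_max_left n k.unop)) y.1 - x.1, ?_, ?_⟩
    · change α.app _ (_ - _) = 0
      rw [map_sub, NatTrans.naturality_apply, hy, hx, limit.w_apply, sub_self]
    · refine (map_sub (A.map (f n)).hom _ _).trans ?_
      congr 1
      exact htf (le_max_left n k.unop) y.1
  rw [hl] at hd
  obtain ⟨z, hz, e⟩ := hd
  have hz' : α.app (i l) z = 0 := hz
  have hw : α.app (i l) (y.1 - z) = limit.π B (i l) b := by
    rw [map_sub, hy, hz', sub_zero]
  let q : i l ⟶ k := (homOfLE ((le_max_right n k.unop).trans (Nat.le_add_left _ _))).op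
  refine ⟨(fibreSystem α b).map q ⟨y.1 - z, hw⟩, Subtype.ext ?_⟩
  change A.map g (A.map q (y.1 - z)) = A.map (f n) x.1
  rw [← ConcreteCategory.comp_apply, ← Functor.map_comp, show q ≫ g = f l from rfl, map_sub]
  have e' : A.map (f l) z = A.map (f l) y.1 - A.map (f n) x.1 := e
  rw [e', sub_sub_cancel]

/-- Sequential limits are exact on inverse systems with Artinian kernels. -/
lemma limMap_exact (α : A ⟶ B) (β : B ⟶ C) (h : ∀ j, Function.Exact (α.app j) (β.app j))
    [∀ j, IsArtinian R (A.obj j)] : Function.Exact (limMap α) (limMap β) := by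
  intro b
  constructor
  · intro hb
    have hne : ∀ j, Nonempty ((fibreSystem α b).obj j) := fun j => by
      obtain ⟨a, ha⟩ := (h j (limit.π B j b)).1 (by
        rw [← limMap_π_apply, hb, map_zero])
      exact ⟨⟨a, ha⟩⟩
    obtain ⟨s⟩ := (fibreSystem_isMittagLeffler α b hne).nonempty_sections
    obtain ⟨a, ha⟩ := exists_limit_elem A (fun j => (s.1 j).1)
      fun j j' f => congrArg Subtype.val (s.2 f)
    refine ⟨a, limit_elem_ext _ _ _ fun j => ?_⟩
    rw [limMap_π_apply, ha]
    exact (s.1 j).2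
  · rintro ⟨a, rfl⟩
    refine limit_elem_ext _ _ _ fun j => ?_
    rw [limMap_π_apply, limMap_π_apply, map_zero]
    exact (h j).apply_apply_eq_zero _

end
end

/-! ### Limits of long exact sequences; adic quotient systems. -/

noncomputable section

open ModuleCat localCohomology

variable {R : Type u} [CommRing R]

/-- The inverse system of the quotients of a module by a decreasing sequence of submodules. -/
def quotientSystem {M : Type u} [AddCommGroup M] [Module R M] (U : ℕ → Submodule R M)
    (hU : Antitone U) : ℕᵒᵖ ⥤ ModuleCat.{u} R where
  obj n := ModuleCat.of R (M ⧸ U n.unop)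
  map f := ModuleCat.ofHom (Submodule.factor (hU f.unop.le))
  map_id n := by
    ext x
    simp
  map_comp f g := by
    ext x
    simp

lemma antitone_pow_smul_top (𝔞 : Ideal R) (M : Type u) [AddCommGroup M] [Module R M] :
    Antitone fun n : ℕ => (𝔞 ^ n • ⊤ : Submodule R M) := fun _ _ h =>
  Submodule.smul_mono_left (Ideal.pow_le_pow_right h)

section ExactSystems

variable (J : Ideal R)

/-- The limit of the local cohomology of an inverse system. -/
abbrev limitHomology (T : ℕᵒᵖ ⥤ ModuleCat.{u} R) (i : ℕ) : ModuleCat.{u} R :=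
  limit (T ⋙ localHomology J i)

/-- The map on limits of local cohomology induced by a map of inverse systems. -/
abbrev limitHomologyMap {T T' : ℕᵒᵖ ⥤ ModuleCat.{u} R} (φ : T ⟶ T') (i : ℕ) :
    limitHomology J T i ⟶ limitHomology J T' i :=
  limMap (Functor.whiskerRight φ (localHomology J i))

variable (S : ShortComplex (ℕᵒᵖ ⥤ ModuleCat.{u} R))
  (hS : ∀ n, (S.map ((evaluation _ _).obj n)).ShortExact)

/-- The connecting map on limits of local cohomology. -/
def limitδ (i : ℕ) : limitHomology J S.X₃ i ⟶ limitHomology J S.X₁ (i + 1) :=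
  limMap
    { app := fun n => localδ (J := J) (hS n) i
      naturality := fun _ _ f =>
        (localδ_naturality (hS _) (hS _) (S.mapNatTrans ((evaluation _ _).map f)) i).symm }

include hS in
-- Exactness at a term needs Artinian modules only in the system just before it.
lemma limitHomology_exact₂ (i : ℕ) [h : ∀ n, IsArtinian R ((localHomology J i).obj (S.X₁.obj n))] :
    Function.Exact (limitHomologyMap J S.f i) (limitHomologyMap J S.g i) :=
  have (n : ℕᵒᵖ) : IsArtinian R ((S.X₁ ⋙ localHomology J i).obj n) := h n
  limMap_exact _ _ fun n => localHomology_exact₂ (hS n) i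

lemma limitHomology_exact₃ (i : ℕ) [h : ∀ n, IsArtinian R ((localHomology J i).obj (S.X₂.obj n))] :
    Function.Exact (limitHomologyMap J S.g i) (limitδ J S hS i) :=
  have (n : ℕᵒᵖ) : IsArtinian R ((S.X₂ ⋙ localHomology J i).obj n) := h n
  limMap_exact _ _ fun n => localHomology_exact₃ (hS n) i

include hS in
lemma isArtinian_limitHomology_X₃ (i : ℕ)
    [∀ n, IsArtinian R ((localHomology J i).obj (S.X₂.obj n))]
    [IsArtinian R (limitHomology J S.X₂ i)] [IsArtinian R (limitHomology J S.X₁ (i + 1))] :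
    IsArtinian R (limitHomology J S.X₃ i) :=
  isArtinian_of_range_eq_ker (limitHomologyMap J S.g i).hom (limitδ J S hS i).hom
    (LinearMap.exact_iff.1 (limitHomology_exact₃ J S hS i)).symm

include hS in
lemma isArtinian_limitHomology_quotient_range (i : ℕ)
    [∀ n, IsArtinian R ((localHomology J i).obj (S.X₂.obj n))]
    [IsArtinian R (limitHomology J S.X₁ (i + 1))] :
    IsArtinian R (limitHomology J S.X₃ i ⧸ LinearMap.range (limitHomologyMap J S.g i).hom) := by
  have h := LinearMap.exact_iff.1 (limitHomology_exact₃ J S hS i)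
  refine isArtinian_of_injective (Submodule.liftQ _ (limitδ J S hS i).hom h.ge) ?_
  rw [← LinearMap.ker_eq_bot]
  exact Submodule.ker_liftQ_eq_bot _ _ _ h.le

end ExactSystems

/-- The map of quotient systems induced by a linear map compatible with the filtrations. -/
def quotientSystemMap {N M : Type u} [AddCommGroup N] [Module R N] [AddCommGroup M] [Module R M]
    {U : ℕ → Submodule R N} (hU : Antitone U) {V : ℕ → Submodule R M} (hV : Antitone V)
    (f : N →ₗ[R] M) (h : ∀ n, U n ≤ (V n).comap f) : quotientSystem U hU ⟶ quotientSystem V hV where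
  app n := ModuleCat.ofHom (Submodule.mapQ _ _ f (h n.unop))
  naturality n n' φ := by
    apply ModuleCat.hom_ext
    apply Submodule.linearMap_qext
    rfl

section Adic

variable (𝔞 : Ideal R) {N M : Type u} [AddCommGroup N] [Module R N] [AddCommGroup M] [Module R M]
  (f : N →ₗ[R] M)

lemma antitone_comap_pow_smul_top :
    Antitone fun n : ℕ => (𝔞 ^ n • ⊤ : Submodule R M).comap f := fun _ _ h =>
  Submodule.comap_mono (antitone_pow_smul_top 𝔞 M h)

lemma pow_smul_top_le_comap (n : ℕ) :
    (𝔞 ^ n • ⊤ : Submodule R N) ≤ (𝔞 ^ n • ⊤ : Submodule R M).comap f := by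
  rw [← Submodule.map_le_iff_le_comap, Submodule.map_smul'']
  exact Submodule.smul_mono le_rfl le_top

/-- The sequences `0 → N ⧸ f⁻¹(𝔞ⁿM) → M ⧸ 𝔞ⁿM → Q ⧸ 𝔞ⁿQ → 0` for a linear map
`f : N → M` with cokernel `Q`. -/
def adicShortComplex : ShortComplex (ℕᵒᵖ ⥤ ModuleCat.{u} R) where
  X₁ := quotientSystem _ (antitone_comap_pow_smul_top 𝔞 f)
  X₂ := quotientSystem _ (antitone_pow_smul_top 𝔞 M)
  X₃ := quotientSystem _ (antitone_pow_smul_top 𝔞 (M ⧸ LinearMap.range f))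
  f := quotientSystemMap _ _ f fun _ => le_rfl
  g := quotientSystemMap _ _ (LinearMap.range f).mkQ (pow_smul_top_le_comap 𝔞 _)
  zero := by
    ext n : 2
    apply ModuleCat.hom_ext
    apply Submodule.linearMap_qext
    ext x
    change Submodule.Quotient.mk (Submodule.Quotient.mk (f x)) = _
    have hx : (Submodule.Quotient.mk (f x) : M ⧸ LinearMap.range f) = 0 :=
      (Submodule.Quotient.mk_eq_zero _).2 ⟨x, rfl⟩
    rw [hx]
    rfl

/-- The preimage filtration on `N` makes the left map injective; middle exactness holds because
`𝔞ⁿM` maps onto `𝔞ⁿ(M ⧸ f(N))`. -/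
lemma adicShortComplex_shortExact (n : ℕᵒᵖ) :
    ((adicShortComplex 𝔞 f).map ((evaluation _ _).obj n)).ShortExact := by
  have hmem : ∀ m : M, (LinearMap.range f).mkQ m ∈
      (𝔞 ^ n.unop • ⊤ : Submodule R (M ⧸ LinearMap.range f)) →
      ∃ x, m - f x ∈ (𝔞 ^ n.unop • ⊤ : Submodule R M) := by
    intro m hm
    have : (𝔞 ^ n.unop • ⊤ : Submodule R M).map (LinearMap.range f).mkQ =
        (𝔞 ^ n.unop • ⊤ : Submodule R (M ⧸ LinearMap.range f)) := by
      rw [Submodule.map_smul'', Submodule.map_top, Submodule.range_mkQ]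
    rw [← this] at hm
    obtain ⟨m', hm', e⟩ := hm
    obtain ⟨x, hx⟩ := (Submodule.Quotient.eq _).1 e.symm
    exact ⟨x, by rwa [hx, sub_sub_cancel]⟩
  refine ModuleCat.shortComplex_shortExact _ ?_ ?_ ?_
  · intro y
    obtain ⟨m, rfl⟩ := Submodule.mkQ_surjective _ y
    constructor
    · intro h
      obtain ⟨x, hx⟩ := hmem m ((Submodule.Quotient.mk_eq_zero _).1 h)
      refine ⟨Submodule.Quotient.mk x, ((Submodule.Quotient.eq _).2 ?_)⟩
      have := Submodule.neg_mem _ hx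
      rwa [neg_sub] at this
    · rintro ⟨z, hz⟩
      rw [← hz]
      exact congrArg (fun g => g.hom z)
        ((adicShortComplex 𝔞 f).map ((evaluation _ _).obj n)).zero
  · change Function.Injective (Submodule.mapQ ((𝔞 ^ n.unop • ⊤ : Submodule R M).comap f)
      (𝔞 ^ n.unop • ⊤) f le_rfl)
    rw [injective_iff_map_eq_zero]
    intro y hy
    obtain ⟨x, rfl⟩ := Submodule.Quotient.mk_surjective _ y
    have hy' : (Submodule.Quotient.mk (f x) : M ⧸ (𝔞 ^ n.unop • ⊤ : Submodule R M)) = 0 := hy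
    have hx : f x ∈ (𝔞 ^ n.unop • ⊤ : Submodule R M) := (Submodule.Quotient.mk_eq_zero _).1 hy'
    exact (Submodule.Quotient.mk_eq_zero _).2 hx
  · intro y
    obtain ⟨y', rfl⟩ := Submodule.mkQ_surjective _ y
    obtain ⟨m, rfl⟩ := Submodule.mkQ_surjective _ y'
    exact ⟨Submodule.Quotient.mk m, rfl⟩

end Adic
end

/-! ### The Noetherian induction. -/

noncomputable section

open ModuleCat localCohomology

variable {R : Type u} [CommRing R]

section

variable (J : Ideal R) {N : Type u} [AddCommGroup N] [Module R N]

/-- From stage `c` on the transition maps are isomorphisms, so the limit embeds in its stage `c`. -/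
lemma isArtinian_limitHomology_of_eventually_bot {U : ℕ → Submodule R N} (hU : Antitone U) (i c : ℕ)
    (hc : ∀ n, c ≤ n → U n = ⊥) [IsArtinian R ((localHomology J i).obj (ModuleCat.of R (N ⧸ U c)))] :
    IsArtinian R (limitHomology J (quotientSystem U hU) i) := by
  have hiso : ∀ (n : ℕ) (h : c ≤ n), IsIso ((quotientSystem U hU).map (homOfLE h).op) := by
    intro n h
    rw [ConcreteCategory.isIso_iff_bijective]
    constructor
    · change Function.Injective (Submodule.factor (hU h))
      rw [injective_iff_map_eq_zero]
      intro y hy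
      obtain ⟨x, rfl⟩ := Submodule.Quotient.mk_surjective _ y
      have hx : x ∈ U c := (Submodule.Quotient.mk_eq_zero _).1 hy
      rw [hc c le_rfl] at hx
      rw [(Submodule.mem_bot R).1 hx]
      rfl
    · exact Submodule.factor_surjective (hU h)
  have : IsArtinian R ((quotientSystem U hU ⋙ localHomology J i).obj (op c)) :=
    ‹IsArtinian R ((localHomology J i).obj (ModuleCat.of R (N ⧸ U c)))›
  refine isArtinian_of_injective
    (limit.π (quotientSystem U hU ⋙ localHomology J i) (op c)).hom fun x y hxy => ?_
  refine limit_elem_ext _ _ _ fun n => ?_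
  rcases le_total c n.unop with h | h
  · have := hiso n.unop h
    have hinj : Function.Injective
        ((quotientSystem U hU ⋙ localHomology J i).map (homOfLE h).op) :=
      ((ConcreteCategory.isIso_iff_bijective _).1
        (inferInstanceAs (IsIso ((localHomology J i).map
          ((quotientSystem U hU).map (homOfLE h).op))))).1
    refine hinj ?_
    rw [limit.w_apply, limit.w_apply]
    exact hxy
  · have e (z : (limitHomology J (quotientSystem U hU) i : ModuleCat R)) :=
      (limit.w_apply (quotientSystem U hU ⋙ localHomology J i) (homOfLE h).op z).symm
    refine (e x).trans (Eq.trans (congrArg _ hxy) (e y).symm)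

/-- A compatible family `y` over `W` is lifted by pushing `y` at stage `n + c` along `N ⧸ W (n + c)
→ N ⧸ U n`. -/
lemma limitHomologyMap_surjective_of_cofinal {U W : ℕ → Submodule R N} (hU : Antitone U)
    (hW : Antitone W) (hUW : ∀ n, U n ≤ W n) (c : ℕ) (hc : ∀ n, W (n + c) ≤ U n) (i : ℕ) :
    Function.Surjective
      (limitHomologyMap J (quotientSystemMap hU hW LinearMap.id hUW) i) := by
  intro y
  let φ (n : ℕ) : ModuleCat.of R (N ⧸ W (n + c)) ⟶ ModuleCat.of R (N ⧸ U n) :=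
    ModuleCat.ofHom (Submodule.factor (hc n))
  obtain ⟨z, hz⟩ := exists_limit_elem (quotientSystem U hU ⋙ localHomology J i)
    (fun n => (localHomology J i).map (φ n.unop) (limit.π
      (quotientSystem W hW ⋙ localHomology J i) (op (n.unop + c)) y)) (by
      intro n n' f
      have hle : n'.unop + c ≤ n.unop + c := Nat.add_le_add_right f.unop.le c
      rw [← limit.w_apply (quotientSystem W hW ⋙ localHomology J i) (homOfLE hle).op]
      have e : φ n.unop ≫ (quotientSystem U hU).map f =
          (quotientSystem W hW).map (homOfLE hle).op ≫ φ n'.unop := by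
        apply ModuleCat.hom_ext
        apply Submodule.linearMap_qext
        rfl
      have e' := ((localHomology J i).map_comp (φ n.unop) ((quotientSystem U hU).map f)).symm.trans
        ((congrArg (localHomology J i).map e).trans ((localHomology J i).map_comp _ _))
      exact LinearMap.congr_fun (congrArg ModuleCat.Hom.hom e') _)
  refine ⟨z, limit_elem_ext _ _ _ fun n => ?_⟩
  rw [limMap_π_apply, hz]
  have hle : n.unop ≤ n.unop + c := Nat.le_add_right _ _
  rw [← limit.w_apply (quotientSystem W hW ⋙ localHomology J i) (homOfLE hle).op]
  have e : φ n.unop ≫ (quotientSystemMap hU hW LinearMap.id hUW).app n =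
      (quotientSystem W hW).map (homOfLE hle).op := by
    apply ModuleCat.hom_ext
    apply Submodule.linearMap_qext
    rfl
  have e' := ((localHomology J i).map_comp (φ n.unop)
    ((quotientSystemMap hU hW LinearMap.id hUW).app n)).symm.trans
      (congrArg (localHomology J i).map e)
  exact LinearMap.congr_fun (congrArg ModuleCat.Hom.hom e') _

lemma limitHomologyMap_eq_smul {T : ℕᵒᵖ ⥤ ModuleCat.{u} R} (φ : T ⟶ T) (r : R)
    (h : ∀ n, φ.app n = r • 𝟙 _) (i : ℕ) (y : limitHomology J T i) :
    limitHomologyMap J φ i y = r • y := by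
  refine limit_elem_ext _ _ _ fun n => ?_
  rw [limMap_π_apply, map_smul, Functor.whiskerRight_app, h]
  exact smul_localHomology J _ r i _

/-- The common core of both cases of the induction: `hrange` says that in degree `t` the
contribution of `X₁` is either Artinian or invisible modulo `𝔞`. -/
lemma isArtinian_limitHomology_X₂_quotient (S : ShortComplex (ℕᵒᵖ ⥤ ModuleCat.{u} R))
    (hS : ∀ n, (S.map ((evaluation _ _).obj n)).ShortExact) (𝔞 : Ideal R) [IsNoetherianRing R]
    (t : ℕ) (hX₁ : ∀ n i, IsArtinian R ((localHomology J i).obj (S.X₁.obj n)))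
    (hX₂ : ∀ n i, IsArtinian R ((localHomology J i).obj (S.X₂.obj n)))
    (h₁ : ∀ i, t < i → IsArtinian R (limitHomology J S.X₁ i))
    (h₂ : ∀ i, t < i → IsArtinian R (limitHomology J S.X₂ i))
    (hrange : IsArtinian R (limitHomology J S.X₁ t) ∨
      LinearMap.range (limitHomologyMap J S.f t).hom ≤ 𝔞 • ⊤)
    (h₃ : (∀ i, t < i → IsArtinian R (limitHomology J S.X₃ i)) →
      IsArtinian R (limitHomology J S.X₃ t ⧸ (𝔞 • ⊤ : Submodule R (limitHomology J S.X₃ t)))) :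
    IsArtinian R (limitHomology J S.X₂ t ⧸ (𝔞 • ⊤ : Submodule R (limitHomology J S.X₂ t))) := by
  have := h₁ (t + 1) t.lt_succ_self
  have hart₃ := h₃ fun i hi =>
    have := h₁ (i + 1) (hi.trans i.lt_succ_self)
    have := h₂ i hi
    isArtinian_limitHomology_X₃ J S hS i
  have hexact := limitHomology_exact₂ J S hS t
  have := isArtinian_limitHomology_quotient_range J S hS t
  rcases hrange with hrange | hrange
  · exact isArtinian_quotient_smul_top_of_exact 𝔞 (limitHomologyMap J S.f t).hom
      (limitHomologyMap J S.g t).hom hexact.apply_apply_eq_zero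
      ((LinearMap.exact_iff.1 hexact).le.trans le_sup_left)
  -- The kernel already lies in `𝔞 • ⊤`, so the zero module can play the role of `A`.
  · exact isArtinian_quotient_smul_top_of_exact 𝔞 (A := PUnit.{1}) 0
      (limitHomologyMap J S.g t).hom (fun _ => map_zero _)
      ((LinearMap.exact_iff.1 hexact).le.trans (hrange.trans le_sup_right))

lemma limitHomologyMap_comp {T T' T'' : ℕᵒᵖ ⥤ ModuleCat.{u} R} (φ : T ⟶ T') (ψ : T' ⟶ T'')
    (i : ℕ) : limitHomologyMap J (φ ≫ ψ) i = limitHomologyMap J φ i ≫ limitHomologyMap J ψ i := by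
  apply limit.hom_ext
  intro n
  simp

end

variable [IsNoetherianRing R] (J 𝔞 : Ideal R) {M : Type u} [AddCommGroup M] [Module R M]
  [Module.Finite R M]

/-- Formal local cohomology in terms of `localHomology`. -/
abbrev formalHomology (M : Type u) [AddCommGroup M] [Module R M] (i : ℕ) : ModuleCat.{u} R :=
  limitHomology J (quotientSystem _ (antitone_pow_smul_top 𝔞 M)) i

/-- Artin–Rees: `𝔞^(k+1)M ∩ N = 𝔞(𝔞^k M ∩ N)`, and `𝔞` kills `N`. -/
lemma exists_comap_pow_smul_top_eq_bot {N : Submodule R M} (hN : ∀ r ∈ 𝔞, ∀ y : N, r • y = 0) :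
    ∃ c, ∀ n, c ≤ n → (𝔞 ^ n • ⊤ : Submodule R M).comap N.subtype = ⊥ := by
  obtain ⟨k, hk⟩ := 𝔞.exists_pow_inf_eq_pow_smul N
  refine ⟨k + 1, fun n hn => ?_⟩
  rw [eq_bot_iff]
  intro y hy
  have hy' : (y : M) ∈ (𝔞 ^ (k + 1) • ⊤ ⊓ N : Submodule R M) :=
    ⟨antitone_pow_smul_top 𝔞 M hn hy, y.2⟩
  rw [hk (k + 1) (Nat.le_add_right k 1), Nat.add_sub_cancel_left, pow_one] at hy'
  have hle : 𝔞 • (𝔞 ^ k • ⊤ ⊓ N) ≤ (⊥ : Submodule R M) := by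
    refine Submodule.smul_le.2 fun r hr z hz => ?_
    exact congrArg Subtype.val (hN r hr ⟨z, hz.2⟩)
  exact Subtype.ext ((Submodule.mem_bot R).1 (hle hy'))

/-- Artin–Rees for `xM` gives `𝔞^(n+k)M ∩ xM ⊆ x𝔞ⁿM`, and `x` cancels. -/
lemma exists_comap_smul_pow_smul_top_le {x : R} (hx : Function.Injective (LinearMap.lsmul R M x)) :
    ∃ c, ∀ n, (𝔞 ^ (n + c) • ⊤ : Submodule R M).comap (LinearMap.lsmul R M x) ≤ 𝔞 ^ n • ⊤ := by
  obtain ⟨k, hk⟩ := 𝔞.exists_pow_inf_eq_pow_smul (LinearMap.range (LinearMap.lsmul R M x))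
  refine ⟨k, fun n m hm => ?_⟩
  have hm' : x • m ∈ (𝔞 ^ (n + k) • ⊤ ⊓ LinearMap.range (LinearMap.lsmul R M x) :
      Submodule R M) := ⟨hm, m, rfl⟩
  rw [hk (n + k) (Nat.le_add_left k n), Nat.add_sub_cancel] at hm'
  have hle : 𝔞 ^ n • (𝔞 ^ k • ⊤ ⊓ LinearMap.range (LinearMap.lsmul R M x)) ≤
      (𝔞 ^ n • ⊤ : Submodule R M).map (LinearMap.lsmul R M x) := by
    rw [Submodule.map_smul'', Submodule.map_top]
    exact Submodule.smul_mono le_rfl inf_le_right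
  obtain ⟨m', hm', e⟩ := hle hm'
  rw [← hx e]
  exact hm'

/-- The comparison of the `𝔞`-adic filtration with its preimage under multiplication by `x`. -/
def smulSystemMap (M : Type u) [AddCommGroup M] [Module R M] (x : R) :
    quotientSystem _ (antitone_pow_smul_top 𝔞 M) ⟶
      (adicShortComplex 𝔞 (LinearMap.lsmul R M x)).X₁ :=
  quotientSystemMap (antitone_pow_smul_top 𝔞 M) (antitone_comap_pow_smul_top 𝔞 _) LinearMap.id
    (pow_smul_top_le_comap 𝔞 (LinearMap.lsmul R M x))

lemma limitHomologyMap_smulSystemMap_surjective {x : R}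
    (hx : Function.Injective (LinearMap.lsmul R M x)) (i : ℕ) :
    Function.Surjective (limitHomologyMap J (smulSystemMap 𝔞 M x) i) := by
  obtain ⟨c, hc⟩ := exists_comap_smul_pow_smul_top_le 𝔞 hx
  exact limitHomologyMap_surjective_of_cofinal J (antitone_pow_smul_top 𝔞 M)
    (antitone_comap_pow_smul_top 𝔞 (LinearMap.lsmul R M x)) (pow_smul_top_le_comap 𝔞 _) c hc i

omit [IsNoetherianRing R] [Module.Finite R M] in
lemma smulSystemMap_comp_app (x : R) (n : ℕᵒᵖ) :
    (smulSystemMap 𝔞 M x ≫ (adicShortComplex 𝔞 (LinearMap.lsmul R M x)).f).app n = x • 𝟙 _ := by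
  apply ModuleCat.hom_ext
  apply Submodule.linearMap_qext
  rfl

/-- By cofinality every class on the left comes from `F^i(M)`, and the composite `F^i(M) → F^i(M)`
is multiplication by `x ∈ 𝔞`. -/
lemma range_limitHomologyMap_smul_le {x : R} (hx : Function.Injective (LinearMap.lsmul R M x))
    (hx𝔞 : x ∈ 𝔞) (i : ℕ) :
    LinearMap.range (limitHomologyMap J (adicShortComplex 𝔞 (LinearMap.lsmul R M x)).f i).hom ≤
      𝔞 • ⊤ := by
  rintro _ ⟨z, rfl⟩
  obtain ⟨w, rfl⟩ := limitHomologyMap_smulSystemMap_surjective J 𝔞 hx i z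
  have hw := limitHomologyMap_eq_smul J _ x (smulSystemMap_comp_app 𝔞 x) i w
  have hcomp := limitHomologyMap_comp J (smulSystemMap 𝔞 M x)
    (adicShortComplex 𝔞 (LinearMap.lsmul R M x)).f i
  have hw' := (LinearMap.congr_fun (congrArg ModuleCat.Hom.hom hcomp) w).symm.trans hw
  exact Set.mem_of_eq_of_mem hw' (Submodule.smul_mem_smul hx𝔞 trivial)

variable [J.IsMaximal]

instance isArtinian_adicShortComplex_X₁ {N : Type u} [AddCommGroup N] [Module R N]
    [Module.Finite R N] (f : N →ₗ[R] M) (n : ℕᵒᵖ) (i : ℕ) :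
    IsArtinian R ((localHomology J i).obj ((adicShortComplex 𝔞 f).X₁.obj n)) :=
  isArtinian_localHomology J i (N ⧸ (𝔞 ^ n.unop • ⊤ : Submodule R M).comap f)

instance isArtinian_adicShortComplex_X₂ {N : Type u} [AddCommGroup N] [Module R N]
    (f : N →ₗ[R] M) (n : ℕᵒᵖ) (i : ℕ) :
    IsArtinian R ((localHomology J i).obj ((adicShortComplex 𝔞 f).X₂.obj n)) :=
  isArtinian_localHomology J i (M ⧸ (𝔞 ^ n.unop • ⊤ : Submodule R M))

section Step

variable {t : ℕ} (h : ∀ i, t < i → IsArtinian R (formalHomology J 𝔞 M i))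

include h

lemma isArtinian_formalHomology_quotient_of_adicShortComplex {N : Type u} [AddCommGroup N]
    [Module R N] [Module.Finite R N] (f : N →ₗ[R] M)
    (h₁ : ∀ i, t < i → IsArtinian R (limitHomology J (adicShortComplex 𝔞 f).X₁ i))
    (hrange : IsArtinian R (limitHomology J (adicShortComplex 𝔞 f).X₁ t) ∨
      LinearMap.range (limitHomologyMap J (adicShortComplex 𝔞 f).f t).hom ≤ 𝔞 • ⊤)
    (ih : (∀ i, t < i → IsArtinian R (formalHomology J 𝔞 (M ⧸ LinearMap.range f) i)) →
      IsArtinian R (formalHomology J 𝔞 (M ⧸ LinearMap.range f) t ⧸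
        (𝔞 • ⊤ : Submodule R (formalHomology J 𝔞 (M ⧸ LinearMap.range f) t)))) :
    IsArtinian R (formalHomology J 𝔞 M t ⧸ (𝔞 • ⊤ : Submodule R (formalHomology J 𝔞 M t))) :=
  isArtinian_limitHomology_X₂_quotient J _ (adicShortComplex_shortExact 𝔞 f) 𝔞 t
    (fun n i => isArtinian_adicShortComplex_X₁ J 𝔞 f n i)
    (fun n i => isArtinian_adicShortComplex_X₂ J 𝔞 f n i) h₁ h hrange ih

variable
  (ih : ∀ V : Submodule R M, V ≠ ⊥ →
    (∀ i, t < i → IsArtinian R (formalHomology J 𝔞 (M ⧸ V) i)) →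
    IsArtinian R (formalHomology J 𝔞 (M ⧸ V) t ⧸
      (𝔞 • ⊤ : Submodule R (formalHomology J 𝔞 (M ⧸ V) t))))

include ih

lemma isArtinian_formalHomology_quotient_of_exists_killed {q : M} (hq : ∀ r ∈ 𝔞, r • q = 0)
    (hq0 : q ≠ 0) :
    IsArtinian R (formalHomology J 𝔞 M t ⧸ (𝔞 • ⊤ : Submodule R (formalHomology J 𝔞 M t))) := by
  obtain ⟨c, hc⟩ := exists_comap_pow_smul_top_eq_bot 𝔞 (smul_span_singleton_eq_zero 𝔞 hq)
  have h₁ (i : ℕ) : IsArtinian R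
      (limitHomology J (adicShortComplex 𝔞 (Submodule.span R {q}).subtype).X₁ i) :=
    have := isArtinian_localHomology J i (Submodule.span R {q} ⧸
      (𝔞 ^ c • ⊤ : Submodule R M).comap (Submodule.span R {q}).subtype)
    isArtinian_limitHomology_of_eventually_bot J
      (antitone_comap_pow_smul_top 𝔞 (Submodule.span R {q}).subtype) i c hc
  refine isArtinian_formalHomology_quotient_of_adicShortComplex J 𝔞 h
    (Submodule.span R {q}).subtype (fun i _ => h₁ i) (Or.inl (h₁ t)) (ih _ ?_)
  rw [Submodule.ne_bot_iff]
  exact ⟨q, ⟨⟨q, Submodule.mem_span_singleton_self q⟩, rfl⟩, hq0⟩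

/-- Nontriviality ensures `xM ≠ 0`, so that `M/xM` is a proper quotient to which `ih` applies. -/
lemma isArtinian_formalHomology_quotient_of_injective_smul [Nontrivial M] {x : R} (hx𝔞 : x ∈ 𝔞)
    (hx : Function.Injective (LinearMap.lsmul R M x)) :
    IsArtinian R (formalHomology J 𝔞 M t ⧸ (𝔞 • ⊤ : Submodule R (formalHomology J 𝔞 M t))) := by
  refine isArtinian_formalHomology_quotient_of_adicShortComplex J 𝔞 h (LinearMap.lsmul R M x)
    (fun i hi => ?_) (Or.inr (range_limitHomologyMap_smul_le J 𝔞 hx hx𝔞 t)) (ih _ ?_)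
  · have := h i hi
    exact isArtinian_of_surjective _ (limitHomologyMap J (smulSystemMap 𝔞 M x) i).hom
      (limitHomologyMap_smulSystemMap_surjective J 𝔞 hx i)
  · obtain ⟨m, hm⟩ := exists_ne (0 : M)
    rw [Submodule.ne_bot_iff]
    exact ⟨_, ⟨m, rfl⟩, fun h0 => hm (hx (h0.trans (map_zero _).symm))⟩

end Step

lemma isArtinian_formalHomology_quotient (M : Type u) [AddCommGroup M] [Module R M]
    [Module.Finite R M] (t : ℕ) (h : ∀ i, t < i → IsArtinian R (formalHomology J 𝔞 M i)) :
    IsArtinian R (formalHomology J 𝔞 M t ⧸ (𝔞 • ⊤ : Submodule R (formalHomology J 𝔞 M t))) := by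
  have key := @Module.Finite.induction_on_quotients R _ _
    (fun Q _ _ => (∀ i, t < i → IsArtinian R (formalHomology J 𝔞 Q i)) →
      IsArtinian R (formalHomology J 𝔞 Q t ⧸ (𝔞 • ⊤ : Submodule R (formalHomology J 𝔞 Q t))))
  refine key (fun Q _ _ _ ih hQ => ?_) M h
  by_cases hq : ∀ q : Q, (∀ r ∈ 𝔞, r • q = 0) → q = 0
  · rcases subsingleton_or_nontrivial Q with hsub | hnt
    · have : Subsingleton (formalHomology J 𝔞 Q t) := by
        refine subsingleton_of_forall_eq 0 fun y => ?_
        -- On a zero system the identity is multiplication by both 0 and 1, hence so it is on the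
        -- limit, which vanishes.
        have h0 := limitHomologyMap_eq_smul J
          (𝟙 (quotientSystem _ (antitone_pow_smul_top 𝔞 Q))) 0 (fun n => ?_) t y
        · have h1 := limitHomologyMap_eq_smul J
            (𝟙 (quotientSystem _ (antitone_pow_smul_top 𝔞 Q))) 1 (fun n => by simp) t y
          rw [← one_smul R y, ← h1, h0, zero_smul]
        · apply ModuleCat.hom_ext
          apply Submodule.linearMap_qext
          ext q
          rw [Subsingleton.elim q 0, map_zero, map_zero]
      infer_instance
    · obtain ⟨x, hx𝔞, hx⟩ := exists_mem_isSMulRegular 𝔞 hq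
      exact isArtinian_formalHomology_quotient_of_injective_smul J 𝔞 hQ ih hx𝔞 hx
  · push Not at hq
    obtain ⟨q, hq𝔞, hq0⟩ := hq
    exact isArtinian_formalHomology_quotient_of_exists_killed J 𝔞 hQ ih hq𝔞 hq0

/-- Formal local cohomology is computed by `formalHomology`. -/
def formalLocalCohomologyIso [IsLocalRing R] (M : Type u) [AddCommGroup M] [Module R M] (i : ℕ) :
    formalLocalCohomology 𝔞 i M ≅ formalHomology (IsLocalRing.maximalIdeal R) 𝔞 M i :=
  lim.mapIso (Functor.isoWhiskerLeft (adicQuotientSystem 𝔞 M)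
    (isoLocalHomology (IsLocalRing.maximalIdeal R) i))

end

theorem theorem2p4 {R : Type u} [CommRing R] [IsLocalRing R] [IsNoetherianRing R]
    (𝔞 : Ideal R) (M : Type u) [AddCommGroup M] [Module R M] [Module.Finite R M] (t : ℕ)
    (h : ∀ i : ℕ, t < i → IsArtinian R (formalLocalCohomology 𝔞 i M)) :
    IsArtinian R (formalLocalCohomology 𝔞 t M ⧸
        (𝔞 • ⊤ : Submodule R (formalLocalCohomology 𝔞 t M))) ∧
      (coassociatedPrimes R (formalLocalCohomology 𝔞 t M) ∩
        PrimeSpectrum.zeroLocus (𝔞 : Set R)).Finite := by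
  have hart : IsArtinian R (formalLocalCohomology 𝔞 t M ⧸
      (𝔞 • ⊤ : Submodule R (formalLocalCohomology 𝔞 t M))) := by
    have := isArtinian_formalHomology_quotient (IsLocalRing.maximalIdeal R) 𝔞 M t fun i hi =>
      have := h i hi
      (formalLocalCohomologyIso 𝔞 M i).toLinearEquiv.isArtinian_iff.1 this
    let e := (formalLocalCohomologyIso 𝔞 M t).toLinearEquiv.symm
    refine isArtinian_of_surjective _
      (Submodule.mapQ (𝔞 • ⊤) (𝔞 • ⊤) e.toLinearMap (by
        rw [← Submodule.map_le_iff_le_comap, Submodule.map_smul'']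
        exact Submodule.smul_mono le_rfl le_top)) ?_
    intro y
    obtain ⟨x, rfl⟩ := Submodule.mkQ_surjective _ y
    obtain ⟨z, rfl⟩ := e.surjective x
    exact ⟨Submodule.Quotient.mk z, rfl⟩
  exact ⟨hart, finite_coassociatedPrimes_inter_zeroLocus 𝔞⟩
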